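/- Let $n\ge 1$. For $1\le p<\infty$, $1\le q\le\infty$ or $p=q=\infty$, let $L^{p,q}=L^{p,q}(\mathbb R^n)$ be the Lorentz space with quasi-norm $$\|g\|_{L^{p,q}}=\Big(p\int_0^\infty[\alpha\mu_g(\alpha)^{1/p}]^q\frac{d\alpha}{\alpha}\Big)^{1/q}\ (p,q<\infty),\qquad \|g\|_{L^{p,\infty}}=\sup_{\alpha>0}\alpha\mu_g(\alpha)^{1/p}\ (p<\infty),\qquad \|g\|_{L^{\infty,\infty}}=\inf\{\alpha>0:\mu_g(\alpha)=0\},$$ where $\mu_g(\alpha)=|\{x\in\mathbb R^n:|g(x)|>\alpha\}|$. Let $\mathscr S_0$ be the space of Schwartz functions $\psi$ on $\mathbb R^n$ with $D^\alpha\hat\psi(0)=0$ for all multi-indices $\alpha$ (with the topology of the Schwartz space), and let $\mathscr S_0'$ be its dual. Let $\varphi=\{\varphi_j\}_{j\in\mathbb Z}\subset C_c^\infty(\mathbb R^n)$ satisfy $\operatorname{supp}\varphi_j\subset\{2^{j-1}\le|\xi|\le2^{j+1}\}$, $\sup_{j,\xi}2^{j|\alpha|}|D^\alpha\varphi_j(\xi)|<\infty$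 for every $\alpha$, and $\sum_{j\in\mathbb Z}\varphi_j(\xi)=1$ for $\xi\ne0$. For $f\in\mathscr S_0'$ put $\Delta_jf=\varphi_j^\vee*f$, that is, $\Delta_jf(x)=\langle f,\varphi_j^\vee(x-\cdot)\rangle$, and let the homogeneous Besov–Lorentz space $\dot B^{s,r}_{p,q}$ be the set of all $f\in\mathscr S_0'$ such that $$\|f\|_{\dot B^{s,r}_{p,q}}=\big\|\{2^{js}\|\Delta_jf\|_{L^{p,q}}\}_{j\in\mathbb Z}\big\|_{l^r(\mathbb Z)}<\infty .$$ **Theorem.** Let $s,s_1,s_2\in\mathbb R$, $1\le p,p_1,p_2,q,q_1,q_2,r,r_1,r_2\le\infty$ and $0<\theta<1$, where $q=\infty$ if $p=\infty$, and $q_i=\infty$ if $p_i=\infty$ ($i=1,2$). Put $$s_*=(1-\theta)s_1+\theta s_2,\quad \frac1{p_*}=\frac{1-\theta}{p_1}+\frac\theta{p_2},\quad \frac1{q_*}=\frac{1-\theta}{q_1}+\frac\theta{q_2},\quad \frac1{r_*}=\frac{1-\theta}{r_1}+\frac\theta{r_2},$$ and assume that $$s_*-s=\frac n{p_*}-\frac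 np\ge0 .$$ Then there is a constant $C<\infty$, independent of $f$, such that $$\|f\|_{\dot B^{s,r}_{p,q}}\le C\,\|f\|_{\dot B^{s_1,r_1}_{p_1,q_1}}^{1-\theta}\,\|f\|_{\dot B^{s_2,r_2}_{p_2,q_2}}^{\theta}\qquad\text{for all } f\in\dot B^{s_1,r_1}_{p_1,q_1}\cap\dot B^{s_2,r_2}_{p_2,q_2},$$ if one of the following conditions is satisfied: (i) $q_*\le q$ and $r_*\le r$; (ii) $s_*=s$, $p_1\ne p_2$ and $r_*\le r$; (iii) $s_*>s$ and $r_*\le r$; (iv) $s_*=s$, $s_1\ne s_2$, $p_1=p_2$ and $\max(q_1,q_2)\le q$; (v) $s_*>s$ and $s_2-s_1\ne n/p_2-n/p_1$. In particular (take $q=r=1$ and $q_1=q_2=r_1=r_2=\infty$ in (v)), $\|f\|_{\dot B^{s,1}_{p,1}}\le C\|f\|_{\dot B^{s_1,\infty}_{p_1,\infty}}^{1-\theta}\|f\|_{\dot B^{s_2,\infty}_{p_2,\infty}}^{\theta}$ whenever $p<\infty$, $1\le p_1,p_2\le\infty$, $s_*>s$ and $s_2-s_1\ne n/p_2-n/p_1$.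 -/

import Mathlib

open MeasureTheory Set
open scoped ENNReal NNReal FourierTransform SchwartzMap

noncomputable section

namespace BesovLorentz

/-- The Euclidean space `ℝⁿ`. -/
abbrev E (n : ℕ) : Type := EuclideanSpace ℝ (Fin n)

/-! ### Lorentz quasi-norms -/

/-- The distribution function `μ_f(α) = |{x : |f(x)| > α}|`. -/
def distribFun {n : ℕ} (f : E n → ℂ) (α : ℝ) : ℝ≥0∞ :=
  volume {x : E n | α < ‖f x‖}

/-- The Lorentz quasi-norm `‖f‖_{L^{p,q}}` with values in `[0, ∞]`.
For `p = ∞` and `q < ∞` it encodes `L^{∞,q} = {0}`. -/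
def lorentzNorm {n : ℕ} (p q : ℝ≥0∞) (f : E n → ℂ) : ℝ≥0∞ :=
  if p = ∞ then
    if q = ∞ then
      ⨅ (α : ℝ) (_ : 0 < α) (_ : distribFun f α = 0), ENNReal.ofReal α
    else
      if distribFun f 0 = 0 then 0 else ∞
  else
    if q = ∞ then
      ⨆ (α : ℝ) (_ : 0 < α), ENNReal.ofReal α * distribFun f α ^ (1 / p.toReal)
    else
      (p * ∫⁻ α in Ioi (0 : ℝ),
        (ENNReal.ofReal α * distribFun f α ^ (1 / p.toReal)) ^ q.toReal / ENNReal.ofReal α)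
          ^ (1 / q.toReal)

/-- The `l^r(ℤ)` norm of a sequence with values in `[0, ∞]`. -/
def seqNorm (r : ℝ≥0∞) (a : ℤ → ℝ≥0∞) : ℝ≥0∞ :=
  if r = ∞ then ⨆ j, a j else (∑' j, a j ^ r.toReal) ^ (1 / r.toReal)

/-! ### Schwartz functions with vanishing moments and their dual -/

/-- The space `𝓢₀` of Schwartz functions whose Fourier transform vanishes at the origin together
with all its derivatives, with the topology induced by the Schwartz space. -/
def schwartzZero (n : ℕ) : Submodule ℂ 𝓢(E n, ℂ) where
  carrier := {g | ∀ k : ℕ, iteratedFDeriv ℝ k (𝓕 g : 𝓢(E n, ℂ)) 0 = 0}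
  zero_mem' := by
    intro k
    have h : (𝓕 (0 : 𝓢(E n, ℂ)) : 𝓢(E n, ℂ)) = 0 := by
      simp
    rw [h]
    have : ((0 : 𝓢(E n, ℂ)) : E n → ℂ) = 0 := rfl
    rw [this, iteratedFDeriv_zero]
    rfl
  add_mem' := by
    intro f g hf hg k
    have h : (𝓕 (f + g) : 𝓢(E n, ℂ)) = 𝓕 f + 𝓕 g := FourierTransform.fourier_add f g
    have h' : ((𝓕 f + 𝓕 g : 𝓢(E n, ℂ)) : E n → ℂ)
        = (𝓕 f : 𝓢(E n, ℂ)) + (𝓕 g : 𝓢(E n, ℂ)) := rfl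
    rw [h, h', iteratedFDeriv_add_apply ((SchwartzMap.smooth _ _).contDiffAt)
      ((SchwartzMap.smooth _ _).contDiffAt), hf k, hg k, add_zero]
  smul_mem' := by
    intro c f hf k
    have h : (𝓕 (c • f) : 𝓢(E n, ℂ)) = c • 𝓕 f := FourierTransform.fourier_smul c f
    have h' : ((c • 𝓕 f : 𝓢(E n, ℂ)) : E n → ℂ) = c • ((𝓕 f : 𝓢(E n, ℂ)) : E n → ℂ) := rfl
    rw [h, h', iteratedFDeriv_const_smul_apply ((SchwartzMap.smooth _ _).contDiffAt), hf k,
      smul_zero]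

/-- The dual `𝓢₀'` of `𝓢₀`: continuous linear functionals on `𝓢₀`. -/
abbrev SchwartzZeroDual (n : ℕ) : Type := schwartzZero n →L[ℂ] ℂ

/-! ### Homogeneous Littlewood-Paley decompositions -/

/-- A smooth dyadic partition of unity `φ = (φ_j)_{j ∈ ℤ}` on `ℝⁿ \ {0}`. The functions are given as
Schwartz functions; by `support` they are compactly supported, so `φ` ranges exactly over the
sequences in `C_c^∞(ℝⁿ)` with the stated properties. -/
structure DyadicPartition (n : ℕ) where
  toFun : ℤ → 𝓢(E n, ℂ)
  support : ∀ j : ℤ, tsupport (toFun j) ⊆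
    {ξ : E n | (2 : ℝ) ^ (j - 1) ≤ ‖ξ‖ ∧ ‖ξ‖ ≤ (2 : ℝ) ^ (j + 1)}
  bound : ∀ k : ℕ, ∃ B : ℝ, ∀ (j : ℤ) (ξ : E n),
    (2 : ℝ) ^ (j * (k : ℤ)) * ‖iteratedFDeriv ℝ k (toFun j) ξ‖ ≤ B
  sum_eq_one : ∀ ξ : E n, ξ ≠ 0 → HasSum (fun j : ℤ => toFun j ξ) 1

/-- The Schwartz function `y ↦ g^∨(x - y)`, where `g^∨` is the inverse Fourier transform of `g`. -/
def convKernel {n : ℕ} (g : 𝓢(E n, ℂ)) (x : E n) : 𝓢(E n, ℂ) :=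
  SchwartzMap.compSubConstCLM ℂ x
    (SchwartzMap.compCLMOfContinuousLinearEquiv ℂ (ContinuousLinearEquiv.neg ℝ)
      (𝓕⁻ g : 𝓢(E n, ℂ)))

lemma convKernel_apply {n : ℕ} (g : 𝓢(E n, ℂ)) (x y : E n) :
    convKernel g x y = (𝓕⁻ g : 𝓢(E n, ℂ)) (x - y) := by
  simp [convKernel, SchwartzMap.compSubConstCLM_apply,
    SchwartzMap.compCLMOfContinuousLinearEquiv]

lemma fourier_convKernel {n : ℕ} (g : 𝓢(E n, ℂ)) (x ξ : E n) :
    (𝓕 (convKernel g x) : 𝓢(E n, ℂ)) ξ = Real.fourierChar (-(inner ℝ x ξ)) • g (-ξ) := by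
  have h1 : g (-ξ) = (𝓕 (𝓕⁻ g : 𝓢(E n, ℂ)) : 𝓢(E n, ℂ)) (-ξ) := by
    rw [FourierTransform.fourier_fourierInv_eq]
  rw [h1, SchwartzMap.fourier_coe, SchwartzMap.fourier_coe, Real.fourier_eq, Real.fourier_eq,
    ← integral_sub_left_eq_self _ volume x, Circle.smul_def, ← integral_smul]
  congr 1
  ext y
  rw [← Circle.smul_def, convKernel_apply, smul_smul, ← AddChar.map_add_eq_mul, sub_sub_cancel]
  congr 2
  rw [inner_sub_left, inner_neg_right]
  ring_nf

lemma convKernel_mem {n : ℕ} (φ : DyadicPartition n) (j : ℤ) (x : E n) :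
    convKernel (φ.toFun j) x ∈ schwartzZero n := by
  intro k
  have h : ((𝓕 (convKernel (φ.toFun j) x) : 𝓢(E n, ℂ)) : E n → ℂ) =ᶠ[nhds 0] fun _ => (0 : ℂ) := by
    have hpos : (0 : ℝ) < (2 : ℝ) ^ (j - 1) := by positivity
    filter_upwards [Metric.ball_mem_nhds (0 : E n) hpos] with ξ hξ
    rw [fourier_convKernel]
    have : φ.toFun j (-ξ) = 0 := by
      by_contra hne
      have := (φ.support j (subset_tsupport _ hne)).1
      rw [norm_neg] at this
      rw [mem_ball_zero_iff] at hξ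
      linarith
    rw [this, smul_zero]
  rw [(h.iteratedFDeriv ℝ k).eq_of_nhds]
  simp

/-- The Littlewood-Paley block `Δ_j f = φ_j^∨ * f` of `f ∈ 𝓢₀'`, a function on `ℝⁿ`: its value at
`x` is `⟨f, φ_j^∨(x - ·)⟩`, which makes sense since `φ_j^∨(x - ·) ∈ 𝓢₀`. -/
def lpBlock {n : ℕ} (φ : DyadicPartition n) (j : ℤ) (f : SchwartzZeroDual n) (x : E n) : ℂ :=
  f ⟨convKernel (φ.toFun j) x, convKernel_mem φ j x⟩

/-- The block `Δ_j f` is the convolution `φ_j^∨ * F` for every extension `F ∈ 𝓢'` of `f`. -/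
lemma lpBlock_eq_of_extension {n : ℕ} (φ : DyadicPartition n) (j : ℤ) (f : SchwartzZeroDual n)
    (F : 𝓢(E n, ℂ) →L[ℂ] ℂ) (hF : ∀ g : schwartzZero n, F g = f g) (x : E n) :
    lpBlock φ j f x = F (convKernel (φ.toFun j) x) :=
  (hF _).symm

/-! ### Homogeneous Besov-Lorentz spaces -/

/-- The quasi-norm `‖f‖ = ‖(2^{js} ‖Δ_j f‖_{L^{p,q}})_j‖_{l^r(ℤ)}` of the homogeneous Besov-Lorentz
space with parameters `s, p, q, r`, with values in `[0, ∞]`. -/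
def besovNorm {n : ℕ} (φ : DyadicPartition n) (s : ℝ) (p q r : ℝ≥0∞) (f : SchwartzZeroDual n) :
    ℝ≥0∞ :=
  seqNorm r fun j : ℤ => ENNReal.ofReal ((2 : ℝ) ^ ((j : ℝ) * s)) * lorentzNorm p q (lpBlock φ j f)

/-- The homogeneous Besov-Lorentz space: all `f ∈ 𝓢₀'` of finite quasi-norm. -/
def besovSpace {n : ℕ} (φ : DyadicPartition n) (s : ℝ) (p q r : ℝ≥0∞) :
    Set (SchwartzZeroDual n) :=
  {f | besovNorm φ s p q r f < ∞}

/-- The number `1 / p ∈ [0, 1]` for an exponent `p ∈ [1, ∞]`, with `1 / ∞ = 0`. -/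
def recip (p : ℝ≥0∞) : ℝ := (p⁻¹).toReal

end BesovLorentz

end

namespace BesovLorentz

/-! ### Interpolated exponents -/

/-! Everything is read off the distribution functions `D` of the blocks. With `κ = 1/p`, the Lorentz
quasi-norm is a constant times the `L^q(dα/α)` norm of `α D(α)^κ` (`lorentzNorm_eq`), and `p = ∞` is
the endpoint `κ = 0`. These level functions are log-linear in `κ`, which gives two interpolation
principles for a single function. Hölder's inequality yields the second index `q_*`, hence every
larger one (`lorentzNorm_le_of_le_interpolated`). If `p₁ ≠ p₂`, two weak-type bounds, used below and
above the level where they balance, yield every second index (`mixNorm_levelFun_le_weakNorm`).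

A gain of integrability comes from the frequency localization of the blocks: `‖Δ_j f‖_∞ ≤ C 2^{jnκ}
‖Δ_j f‖_{L^{1/κ,∞}}` (`weakNorm_zero_lpBlock_le`). To prove it, the block is written as its
convolution with the Fourier transform of a cutoff. The integral is split at a level `l`: values
below `l` contribute `O(l)`, while the set of larger values is so small that its contribution is
absorbed into the supremum. The representation itself holds because `f` factors through a bounded
functional on a Banach space of weighted jets, where it commutes with Bochner integrals.

When `r_* ≤ r`, a blockwise inequality with the factor `2^{j(s_*-s)}` is summed by Hölder in `j`
(`besovNorm_le_of_block_le`). If `s_* > s`, interpolating between `κ = 0` and `κ = 1/p_*` produces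
exactly this factor for every `q` (`lorentzNorm_lpBlock_le`).

In (iv) and (v) no relation between the `r`'s is needed. The weighted block norms satisfy two
bounds, one growing and one decaying geometrically in `j d` with `d ≠ 0`, so even their `l¹` norm is
controlled by the geometric mean (`tsum_le_of_two_sided`). In (iv), `d = s₂ - s₁`. In (v), the
supremum of the block is estimated from either endpoint space, and `d` is a positive multiple of the
difference of the differential dimensions `s_i - n/p_i`. -/

lemma inv_ne_top_of_one_le {p : ℝ≥0∞} (hp : 1 ≤ p) : p⁻¹ ≠ ∞ :=
  ENNReal.inv_ne_top.2 (zero_lt_one.trans_le hp).ne'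

section Exponents

variable {θ : ℝ} {p p₁ p₂ : ℝ≥0∞}

lemma one_le_of_inv_eq (hθ0 : 0 < θ) (hθ1 : θ < 1) (hp₁ : 1 ≤ p₁) (hp₂ : 1 ≤ p₂)
    (h : p⁻¹ = ENNReal.ofReal (1 - θ) * p₁⁻¹ + ENNReal.ofReal θ * p₂⁻¹) : 1 ≤ p := by
  rw [← ENNReal.inv_le_one, h]
  calc _ ≤ ENNReal.ofReal (1 - θ) * 1 + ENNReal.ofReal θ * 1 := by
        gcongr <;> simpa using by assumption
    _ = 1 := by
        rw [mul_one, mul_one, ← ENNReal.ofReal_add (by linarith) hθ0.le]; simp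

lemma recip_eq_of_inv_eq (hθ0 : 0 < θ) (hθ1 : θ < 1) (hp₁ : 1 ≤ p₁) (hp₂ : 1 ≤ p₂)
    (h : p⁻¹ = ENNReal.ofReal (1 - θ) * p₁⁻¹ + ENNReal.ofReal θ * p₂⁻¹) :
    recip p = (1 - θ) * recip p₁ + θ * recip p₂ := by
  have hθ' : 0 < 1 - θ := by linarith
  rw [recip, h, ENNReal.toReal_add, ENNReal.toReal_mul, ENNReal.toReal_mul,
    ENNReal.toReal_ofReal hθ'.le, ENNReal.toReal_ofReal hθ0.le]
  · rfl
  · exact ENNReal.mul_ne_top ENNReal.ofReal_ne_top (inv_ne_top_of_one_le hp₁)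
  · exact ENNReal.mul_ne_top ENNReal.ofReal_ne_top (inv_ne_top_of_one_le hp₂)

end Exponents

/-! ### Mixed supremum/integral norms -/

/-- The `L^q` norm of a `[0, ∞]`-valued function, with the supremum in place of the essential
supremum for `q = ∞`. -/
noncomputable def mixNorm {X : Type*} [MeasurableSpace X] (ν : Measure X) (q : ℝ≥0∞)
    (F : X → ℝ≥0∞) : ℝ≥0∞ :=
  if q = ∞ then ⨆ x, F x else (∫⁻ x, F x ^ q.toReal ∂ν) ^ (1 / q.toReal)

section MixNorm

variable {X : Type*} [MeasurableSpace X] {ν : Measure X} {q : ℝ≥0∞} {F G : X → ℝ≥0∞}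

lemma mixNorm_top : mixNorm ν ∞ F = ⨆ x, F x := if_pos rfl

lemma mixNorm_of_ne_top (hq : q ≠ ∞) :
    mixNorm ν q F = (∫⁻ x, F x ^ q.toReal ∂ν) ^ (1 / q.toReal) := if_neg hq

lemma toReal_pos_of_one_le (hq1 : 1 ≤ q) (hq : q ≠ ∞) : 0 < q.toReal :=
  ENNReal.toReal_pos (by rintro rfl; simp at hq1) hq

lemma mixNorm_rpow (hq1 : 1 ≤ q) (hq : q ≠ ∞) :
    mixNorm ν q F ^ q.toReal = ∫⁻ x, F x ^ q.toReal ∂ν := by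
  have := toReal_pos_of_one_le hq1 hq
  rw [mixNorm_of_ne_top hq, ← ENNReal.rpow_mul, one_div, inv_mul_cancel₀ this.ne',
    ENNReal.rpow_one]

lemma mixNorm_le_of_lintegral_le (hq1 : 1 ≤ q) (hq : q ≠ ∞) {A : ℝ≥0∞}
    (h : ∫⁻ x, F x ^ q.toReal ∂ν ≤ A ^ q.toReal) : mixNorm ν q F ≤ A := by
  have := toReal_pos_of_one_le hq1 hq
  rw [mixNorm_of_ne_top hq, one_div, ENNReal.rpow_inv_le_iff this]
  exact h

lemma mixNorm_mono (h : ∀ x, F x ≤ G x) : mixNorm ν q F ≤ mixNorm ν q G := by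
  unfold mixNorm
  split_ifs
  · exact iSup_mono h
  · gcongr
    exact h _

lemma mixNorm_const_mul (hq1 : 1 ≤ q) {c : ℝ≥0∞} (hc : c ≠ ∞) :
    mixNorm ν q (fun x => c * F x) = c * mixNorm ν q F := by
  unfold mixNorm
  split_ifs with hq
  · rw [ENNReal.mul_iSup]
  · have := toReal_pos_of_one_le hq1 hq
    simp_rw [ENNReal.mul_rpow_of_nonneg _ _ this.le]
    rw [lintegral_const_mul' _ _ (ENNReal.rpow_ne_top_of_nonneg this.le hc),
      ENNReal.mul_rpow_of_nonneg _ _ (by positivity), ← ENNReal.rpow_mul, one_div,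
      mul_inv_cancel₀ this.ne', ENNReal.rpow_one]

lemma mixNorm_zero (hq1 : 1 ≤ q) : mixNorm ν q (fun _ => 0) = 0 := by
  simpa using mixNorm_const_mul (ν := ν) (F := fun _ => 0) hq1 ENNReal.zero_ne_top

/-- Hölder's inequality in the form of an interpolation inequality. -/
lemma mixNorm_mul_rpow_le {θ : ℝ} (hθ0 : 0 < θ) (hθ1 : θ < 1) {q q₁ q₂ : ℝ≥0∞}
    (hq₁ : 1 ≤ q₁) (hq₂ : 1 ≤ q₂)
    (hq : q⁻¹ = ENNReal.ofReal (1 - θ) * q₁⁻¹ + ENNReal.ofReal θ * q₂⁻¹)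
    {F₁ F₂ : X → ℝ≥0∞} (h₁ : Measurable F₁) (h₂ : Measurable F₂) :
    mixNorm ν q (fun x => F₁ x ^ (1 - θ) * F₂ x ^ θ)
      ≤ mixNorm ν q₁ F₁ ^ (1 - θ) * mixNorm ν q₂ F₂ ^ θ := by
  have hθ' : 0 < 1 - θ := by linarith
  have hone := one_le_of_inv_eq hθ0 hθ1 hq₁ hq₂ hq
  have hpos₁ : ENNReal.ofReal (1 - θ) ≠ 0 := by simpa using hθ1
  have hpos₂ : ENNReal.ofReal θ ≠ 0 := by simpa using hθ0
  have hreal : q.toReal⁻¹ = (1 - θ) * q₁.toReal⁻¹ + θ * q₂.toReal⁻¹ := by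
    simpa only [recip, ENNReal.toReal_inv] using recip_eq_of_inv_eq hθ0 hθ1 hq₁ hq₂ hq
  have htop : q = ∞ ↔ q₁ = ∞ ∧ q₂ = ∞ := by
    rw [← ENNReal.inv_eq_zero, hq]
    simp [hpos₁, hpos₂]
  by_cases t : q = ∞
  · obtain ⟨t₁, t₂⟩ := htop.1 t
    subst t t₁ t₂
    simp only [mixNorm_top]
    refine iSup_le fun x => ?_
    gcongr
    · exact le_iSup F₁ x
    · exact le_iSup F₂ x
  have hqpos := toReal_pos_of_one_le hone t
  apply mixNorm_le_of_lintegral_le hone t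
  simp_rw [ENNReal.mul_rpow_of_nonneg _ _ hqpos.le, ← ENNReal.rpow_mul]
  by_cases t₁ : q₁ = ∞
  · have t₂ : q₂ ≠ ∞ := fun t₂ => t (htop.2 ⟨t₁, t₂⟩)
    have hp₂ := toReal_pos_of_one_le hq₂ t₂
    have e : θ * q.toReal = q₂.toReal := by
      rw [t₁] at hreal
      simp only [ENNReal.toReal_top, inv_zero, mul_zero, zero_add] at hreal
      field_simp at hreal
      linarith
    rw [e, mixNorm_rpow hq₂ t₂, t₁, mixNorm_top, ← lintegral_const_mul _ (h₂.pow_const _)]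
    refine lintegral_mono fun x => ?_
    gcongr
    exact le_iSup F₁ x
  have hp₁ := toReal_pos_of_one_le hq₁ t₁
  by_cases t₂ : q₂ = ∞
  · have e : (1 - θ) * q.toReal = q₁.toReal := by
      rw [t₂] at hreal
      simp only [ENNReal.toReal_top, inv_zero, mul_zero, add_zero] at hreal
      field_simp at hreal
      linarith
    rw [e, mixNorm_rpow hq₁ t₁, t₂, mixNorm_top, ← lintegral_mul_const _ (h₁.pow_const _)]
    refine lintegral_mono fun x => ?_
    gcongr
    exact le_iSup F₂ x
  have hp₂ := toReal_pos_of_one_le hq₂ t₂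
  -- The Hölder weights `(1-θ)q/q₁` and `θq/q₂` sum to one by the definition of `q`. The preceding
  -- cases are those in which one weight degenerates to zero and that factor is bounded by its
  -- supremum.
  have key := ENNReal.lintegral_mul_norm_pow_le (μ := ν) (f := fun x => F₁ x ^ q₁.toReal)
    (g := fun x => F₂ x ^ q₂.toReal) (h₁.pow_const _).aemeasurable (h₂.pow_const _).aemeasurable
    (p := (1 - θ) * q.toReal / q₁.toReal) (q := θ * q.toReal / q₂.toReal)
    (by positivity) (by positivity)
    (by
      have : q.toReal * q.toReal⁻¹ = 1 := mul_inv_cancel₀ hqpos.ne'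
      rw [hreal] at this
      refine Eq.trans ?_ this
      ring)
  rw [← mixNorm_rpow hq₁ t₁, ← mixNorm_rpow hq₂ t₂] at key
  simp_rw [← ENNReal.rpow_mul] at key
  rw [mul_div_cancel₀ _ hp₁.ne', mul_div_cancel₀ _ hp₂.ne'] at key
  exact key

/-- If the supremum is controlled by the `L^q` norm, then the `L^q` norm controls the norms of
larger exponent. -/
lemma mixNorm_le_of_le {q q' : ℝ≥0∞} (hq : 1 ≤ q) (hqq' : q ≤ q') (hF : Measurable F)
    {C : ℝ≥0∞} (hC : 1 ≤ C) (h : ∀ x, F x ≤ C * mixNorm ν q F) :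
    mixNorm ν q' F ≤ C * mixNorm ν q F := by
  have hC' : mixNorm ν q F ≤ C * mixNorm ν q F := le_mul_of_one_le_left' hC
  by_cases t' : q' = ∞
  · rw [t', mixNorm_top]
    exact iSup_le h
  rcases hqq'.eq_or_lt with rfl | hlt
  · exact hC'
  have t : q ≠ ∞ := hlt.ne_top
  have hp := toReal_pos_of_one_le hq t
  have hp' := toReal_pos_of_one_le (hq.trans hqq') t'
  have hlt' : q.toReal < q'.toReal := (ENNReal.toReal_lt_toReal t t').2 hlt
  apply mixNorm_le_of_lintegral_le (hq.trans hqq') t'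
  have hd : 0 ≤ q'.toReal - q.toReal := by linarith
  -- The surplus power `q' - q` is bounded by the supremum, and the remaining power `q` is
  -- integrated.
  have split : ∀ y : ℝ≥0∞, y ^ q'.toReal = y ^ (q'.toReal - q.toReal) * y ^ q.toReal := fun y => by
    rw [← ENNReal.rpow_add_of_nonneg _ _ hd hp.le, sub_add_cancel]
  rw [split]
  calc ∫⁻ x, F x ^ q'.toReal ∂ν
      ≤ ∫⁻ x, (C * mixNorm ν q F) ^ (q'.toReal - q.toReal) * F x ^ q.toReal ∂ν := by
        refine lintegral_mono fun x => ?_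
        simp only [split (F x)]
        gcongr
        exact h x
    _ = (C * mixNorm ν q F) ^ (q'.toReal - q.toReal) * mixNorm ν q F ^ q.toReal := by
        rw [lintegral_const_mul _ (hF.pow_const _), mixNorm_rpow hq t]
    _ ≤ _ := by gcongr

end MixNorm

/-- Lets the same Hölder and embedding lemmas serve both the level variable and the dyadic index. -/
lemma seqNorm_eq_mixNorm (r : ℝ≥0∞) (a : ℤ → ℝ≥0∞) :
    seqNorm r a = mixNorm Measure.count r a := by
  unfold seqNorm mixNorm
  simp only [lintegral_count]

lemma le_seqNorm {r : ℝ≥0∞} (hr : 1 ≤ r) (a : ℤ → ℝ≥0∞) (j : ℤ) : a j ≤ seqNorm r a := by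
  rw [seqNorm_eq_mixNorm]
  by_cases t : r = ∞
  · rw [t, mixNorm_top]
    exact le_iSup a j
  · have hp := toReal_pos_of_one_le hr t
    rw [← ENNReal.rpow_le_rpow_iff hp, mixNorm_rpow hr t, lintegral_count]
    exact ENNReal.le_tsum (f := fun j => a j ^ r.toReal) j

lemma seqNorm_mono {r : ℝ≥0∞} {a b : ℤ → ℝ≥0∞} (h : ∀ j, a j ≤ b j) :
    seqNorm r a ≤ seqNorm r b := by
  simp only [seqNorm_eq_mixNorm]
  exact mixNorm_mono h

lemma seqNorm_const_mul {r : ℝ≥0∞} (hr : 1 ≤ r) {c : ℝ≥0∞} (hc : c ≠ ∞) (a : ℤ → ℝ≥0∞) :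
    seqNorm r (fun j => c * a j) = c * seqNorm r a := by
  simp only [seqNorm_eq_mixNorm]
  exact mixNorm_const_mul hr hc

lemma seqNorm_le_of_le {r r' : ℝ≥0∞} (hr : 1 ≤ r) (h : r ≤ r') (a : ℤ → ℝ≥0∞) :
    seqNorm r' a ≤ seqNorm r a := by
  have := mixNorm_le_of_le (ν := Measure.count) (F := a) hr h (measurable_of_countable a) le_rfl
    (fun x => by rw [one_mul, ← seqNorm_eq_mixNorm]; exact le_seqNorm hr a x)
  simpa [seqNorm_eq_mixNorm] using this

lemma seqNorm_one (a : ℤ → ℝ≥0∞) : seqNorm 1 a = ∑' j, a j := by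
  simp [seqNorm]

lemma seqNorm_mul_rpow_le {θ : ℝ} (hθ0 : 0 < θ) (hθ1 : θ < 1) {r r₁ r₂ : ℝ≥0∞}
    (hr₁ : 1 ≤ r₁) (hr₂ : 1 ≤ r₂)
    (hr : r⁻¹ = ENNReal.ofReal (1 - θ) * r₁⁻¹ + ENNReal.ofReal θ * r₂⁻¹) (a b : ℤ → ℝ≥0∞) :
    seqNorm r (fun j => a j ^ (1 - θ) * b j ^ θ)
      ≤ seqNorm r₁ a ^ (1 - θ) * seqNorm r₂ b ^ θ := by
  simp only [seqNorm_eq_mixNorm]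
  exact mixNorm_mul_rpow_le hθ0 hθ1 hr₁ hr₂ hr (measurable_of_countable _)
    (measurable_of_countable _)

/-! ### The scale of Lorentz quasi-norms of a distribution function -/

/-- The function `α ↦ α D(α)^κ`, which is understood to vanish where `D(α) = 0`. -/
noncomputable def levelFun (κ : ℝ) (D : ℝ → ℝ≥0∞) (α : ℝ) : ℝ≥0∞ :=
  ENNReal.ofReal α * (if D α = 0 then 0 else D α ^ κ)

/-- The measure `dα / α` on `(0, ∞)`. -/
noncomputable def logMeasure : Measure ℝ :=
  (volume.restrict (Ioi 0)).withDensity fun α => (ENNReal.ofReal α)⁻¹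

/-- The weak-type quasi-norm `sup_α α D(α)^κ`. -/
noncomputable def weakNorm (κ : ℝ) (D : ℝ → ℝ≥0∞) : ℝ≥0∞ := ⨆ α, levelFun κ D α

/-- The normalizing factor of the Lorentz quasi-norm. -/
noncomputable def lorentzConst (p q : ℝ≥0∞) : ℝ≥0∞ :=
  if q = ∞ then 1 else p ^ (1 / q.toReal)

section LevelFun

variable {κ κ₁ κ₂ θ : ℝ} {D : ℝ → ℝ≥0∞} {α : ℝ}

lemma distribFun_antitone {n : ℕ} (u : E n → ℂ) : Antitone (distribFun u) :=
  fun _ _ h => measure_mono fun _ hx => lt_of_le_of_lt h hx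

lemma levelFun_le_weakNorm (α : ℝ) : levelFun κ D α ≤ weakNorm κ D := le_iSup (levelFun κ D) α

lemma levelFun_of_nonpos (h : α ≤ 0) : levelFun κ D α = 0 := by
  simp [levelFun, ENNReal.ofReal_of_nonpos h]

lemma levelFun_of_pos (hκ : 0 < κ) (α : ℝ) : levelFun κ D α = ENNReal.ofReal α * D α ^ κ := by
  unfold levelFun
  split_ifs with h
  · rw [h, ENNReal.zero_rpow_of_pos hκ]
  · rfl

lemma measurable_levelFun (hD : Antitone D) : Measurable (levelFun κ D) := by
  have hm : Measurable D := hD.measurable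
  exact ENNReal.measurable_ofReal.mul
    (Measurable.ite (hm (measurableSet_singleton 0)) measurable_const (hm.pow_const _))

lemma lintegral_logMeasure (g : ℝ → ℝ≥0∞) :
    ∫⁻ α, g α ∂logMeasure = ∫⁻ α in Ioi (0 : ℝ), g α / ENNReal.ofReal α := by
  rw [logMeasure, lintegral_withDensity_eq_lintegral_mul_non_measurable _
    (show Measurable fun α : ℝ => (ENNReal.ofReal α)⁻¹ from ENNReal.measurable_ofReal.inv)]
  · simp only [Pi.mul_apply, div_eq_mul_inv, mul_comm]
  · filter_upwards [self_mem_ae_restrict measurableSet_Ioi] with α hα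
    simpa using hα

lemma lorentzConst_ne_zero {p q : ℝ≥0∞} (hp : 1 ≤ p) (hpq : p = ∞ → q = ∞) :
    lorentzConst p q ≠ 0 := by
  unfold lorentzConst
  split_ifs with hq
  · exact one_ne_zero
  · have hp' : p ≠ ∞ := fun h => hq (hpq h)
    have : p ≠ 0 := by rintro rfl; simp at hp
    simp [this, hp']

lemma lorentzConst_ne_top {p q : ℝ≥0∞} (hpq : p = ∞ → q = ∞) : lorentzConst p q ≠ ∞ := by
  unfold lorentzConst
  split_ifs with hq
  · exact ENNReal.one_ne_top
  · exact ENNReal.rpow_ne_top_of_nonneg (by positivity) fun h => hq (hpq h)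

lemma recip_nonneg (p : ℝ≥0∞) : 0 ≤ recip p := ENNReal.toReal_nonneg

/-- Since `0 ^ 0 = 1`, the convention that `levelFun` vanishes where `D = 0` is what makes the case
`κ = 0` the essential supremum instead of `∞`. -/
lemma iInf_distribFun_eq_weakNorm (hD : Antitone D) :
    (⨅ (α : ℝ) (_ : 0 < α) (_ : D α = 0), ENNReal.ofReal α) = weakNorm 0 D := by
  apply le_antisymm
  · refine le_of_forall_gt fun c hc => ?_
    obtain ⟨b, hb1, hb2⟩ := exists_between hc
    have hbt : b ≠ ∞ := hb2.ne_top
    have hb0 : 0 < b.toReal := ENNReal.toReal_pos (zero_le.trans_lt hb1).ne' hbt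
    have hD0 : D b.toReal = 0 := by
      by_contra h
      have := levelFun_le_weakNorm (κ := 0) (D := D) b.toReal
      simp only [levelFun, h, if_false, ENNReal.rpow_zero, mul_one, ENNReal.ofReal_toReal hbt]
        at this
      exact this.not_gt hb1
    calc _ ≤ ENNReal.ofReal b.toReal := iInf₂_le_of_le _ hb0 (iInf_le _ hD0)
      _ = b := ENNReal.ofReal_toReal hbt
      _ < c := hb2
  · refine iSup_le fun α => le_iInf₂ fun β _ => le_iInf fun hβ => ?_
    unfold levelFun
    split_ifs with h
    · simp
    · rw [ENNReal.rpow_zero, mul_one]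
      apply ENNReal.ofReal_le_ofReal
      by_contra! hlt
      exact h (le_antisymm ((hD hlt.le).trans_eq hβ) zero_le)

/-- Brings all finite and infinite cases of the quasi-norm into one form, in which `p` enters only
through `1/p`, apart from the normalizing constant. -/
lemma lorentzNorm_eq {n : ℕ} {p q : ℝ≥0∞} (hp : 1 ≤ p) (hpq : p = ∞ → q = ∞) (u : E n → ℂ) :
    lorentzNorm p q u
      = lorentzConst p q * mixNorm logMeasure q (levelFun (recip p) (distribFun u)) := by
  unfold lorentzNorm
  by_cases tp : p = ∞
  · rw [if_pos tp, if_pos (hpq tp), hpq tp, mixNorm_top, lorentzConst, if_pos rfl, one_mul, tp]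
    simpa [recip, weakNorm] using iInf_distribFun_eq_weakNorm (distribFun_antitone u)
  have hpos := toReal_pos_of_one_le hp tp
  have hκ : recip p = 1 / p.toReal := by rw [recip, ENNReal.toReal_inv, one_div]
  have hκ0 : 0 < recip p := by rw [hκ]; positivity
  rw [if_neg tp]
  by_cases tq : q = ∞
  · rw [if_pos tq, tq, mixNorm_top, lorentzConst, if_pos rfl, one_mul]
    refine iSup_congr fun α => ?_
    rw [levelFun_of_pos hκ0, hκ]
    by_cases hα : 0 < α
    · simp [hα]
    · simp [hα, ENNReal.ofReal_of_nonpos (not_lt.1 hα)]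
  · rw [if_neg tq, mixNorm_of_ne_top tq, lorentzConst, if_neg tq,
      ← ENNReal.mul_rpow_of_nonneg _ _ (by positivity), lintegral_logMeasure]
    simp_rw [levelFun_of_pos hκ0, hκ]

/-- The level functions form a multiplicative scale. -/
lemma levelFun_rpow_mul_rpow (hκ₁ : 0 ≤ κ₁) (hκ₂ : 0 ≤ κ₂) (hθ0 : 0 < θ) (hθ1 : θ < 1) (α : ℝ) :
    levelFun ((1 - θ) * κ₁ + θ * κ₂) D α
      = levelFun κ₁ D α ^ (1 - θ) * levelFun κ₂ D α ^ θ := by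
  have hθ' : 0 < 1 - θ := by linarith
  unfold levelFun
  rw [ENNReal.mul_rpow_of_nonneg _ _ hθ'.le, ENNReal.mul_rpow_of_nonneg _ _ hθ0.le,
    mul_mul_mul_comm, ← ENNReal.rpow_add_of_nonneg _ _ hθ'.le hθ0.le, sub_add_cancel,
    ENNReal.rpow_one]
  congr 1
  split_ifs with h
  · simp [hθ0]
  · rw [ENNReal.rpow_add_of_nonneg _ _ (by positivity) (by positivity), ← ENNReal.rpow_mul,
      ← ENNReal.rpow_mul, mul_comm κ₁, mul_comm κ₂]

lemma weakNorm_le_rpow_mul_rpow (hκ₁ : 0 ≤ κ₁) (hκ₂ : 0 ≤ κ₂) (hθ0 : 0 < θ) (hθ1 : θ < 1) :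
    weakNorm ((1 - θ) * κ₁ + θ * κ₂) D ≤ weakNorm κ₁ D ^ (1 - θ) * weakNorm κ₂ D ^ θ := by
  have hθ' : 0 < 1 - θ := by linarith
  refine iSup_le fun α => ?_
  rw [levelFun_rpow_mul_rpow hκ₁ hκ₂ hθ0 hθ1]
  gcongr <;> exact levelFun_le_weakNorm α

/-- The constant in the embedding of `L^{p,q}` into weak `L^p`. -/
noncomputable def embedConst (q : ℝ≥0∞) : ℝ≥0∞ :=
  if q = ∞ then 1 else (2 * 2 ^ q.toReal) ^ (1 / q.toReal)

lemma one_le_rpow_of_nonneg {x : ℝ≥0∞} {z : ℝ} (hx : 1 ≤ x) (hz : 0 ≤ z) : 1 ≤ x ^ z :=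
  (ENNReal.one_rpow z).symm.trans_le (ENNReal.rpow_le_rpow hx hz)

lemma one_le_embedConst (q : ℝ≥0∞) : 1 ≤ embedConst q := by
  unfold embedConst
  split_ifs
  · exact le_rfl
  · refine one_le_rpow_of_nonneg ?_ (by positivity)
    calc (1 : ℝ≥0∞) = 1 * 1 := (one_mul 1).symm
      _ ≤ 2 * 2 ^ q.toReal := mul_le_mul' one_le_two
          (one_le_rpow_of_nonneg one_le_two ENNReal.toReal_nonneg)

lemma embedConst_ne_top (q : ℝ≥0∞) : embedConst q ≠ ∞ := by
  unfold embedConst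
  split_ifs
  · exact ENNReal.one_ne_top
  · exact ENNReal.rpow_ne_top_of_nonneg (by positivity)
      (ENNReal.mul_ne_top (by simp) (ENNReal.rpow_ne_top_of_nonneg (by positivity) (by simp)))

/-- For `β ∈ (α/2, α]` monotonicity of `D` makes the level function at `β` at least half its value
at `α`, and this interval has `dβ/β`-mass at least `1/2`. This accounts for the two factors in `2 *
2^q`. -/
lemma levelFun_le_mixNorm (hκ : 0 ≤ κ) (hD : Antitone D) {q : ℝ≥0∞} (hq1 : 1 ≤ q) (α : ℝ) :
    levelFun κ D α ≤ embedConst q * mixNorm logMeasure q (levelFun κ D) := by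
  unfold embedConst
  split_ifs with hq
  · rw [hq, one_mul, mixNorm_top]
    exact le_iSup (levelFun κ D) α
  rcases le_or_gt α 0 with hα | hα
  · rw [levelFun_of_nonpos hα]; exact zero_le
  have hp := toReal_pos_of_one_le hq1 hq
  rw [← ENNReal.rpow_le_rpow_iff hp, ENNReal.mul_rpow_of_nonneg _ _ hp.le, mixNorm_rpow hq1 hq,
    ← ENNReal.rpow_mul, one_div, inv_mul_cancel₀ hp.ne', ENNReal.rpow_one, lintegral_logMeasure]
  have hlow : ∀ β ∈ Ioc (α / 2) α,
      levelFun κ D α ^ q.toReal * ((2 : ℝ≥0∞) ^ q.toReal)⁻¹ * (ENNReal.ofReal α)⁻¹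
        ≤ levelFun κ D β ^ q.toReal / ENNReal.ofReal β := by
    intro β hβ
    have h1 : levelFun κ D α ≤ 2 * levelFun κ D β := by
      unfold levelFun
      rw [← mul_assoc]
      gcongr ?_ * ?_
      · rw [show (2 : ℝ≥0∞) = ENNReal.ofReal 2 by simp, ← ENNReal.ofReal_mul (by norm_num)]
        exact ENNReal.ofReal_le_ofReal (by linarith [hβ.1])
      · have := hD hβ.2
        by_cases h : D α = 0
        · simp [h]
        · have h' : D β ≠ 0 := fun h0 => h (le_antisymm (this.trans_eq h0) zero_le)
          rw [if_neg h, if_neg h']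
          gcongr
    have h2 : levelFun κ D α ^ q.toReal ≤ 2 ^ q.toReal * levelFun κ D β ^ q.toReal := by
      rw [← ENNReal.mul_rpow_of_nonneg _ _ hp.le]
      gcongr
    rw [div_eq_mul_inv]
    gcongr ?_ * ?_
    · rw [← div_eq_mul_inv]
      refine ENNReal.div_le_of_le_mul ?_
      rwa [mul_comm]
    · simp only [ENNReal.inv_le_inv]
      exact ENNReal.ofReal_le_ofReal hβ.2
  have h3 : levelFun κ D α ^ q.toReal * ((2 : ℝ≥0∞) ^ q.toReal)⁻¹ * (ENNReal.ofReal α)⁻¹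
      * ENNReal.ofReal (α / 2)
      ≤ ∫⁻ β in Ioi (0 : ℝ), levelFun κ D β ^ q.toReal / ENNReal.ofReal β := by
    calc _ = ∫⁻ _ in Ioc (α / 2) α,
          levelFun κ D α ^ q.toReal * ((2 : ℝ≥0∞) ^ q.toReal)⁻¹ * (ENNReal.ofReal α)⁻¹ := by
          rw [setLIntegral_const, Real.volume_Ioc]
          congr 2
          ring
      _ ≤ ∫⁻ β in Ioc (α / 2) α, levelFun κ D β ^ q.toReal / ENNReal.ofReal β :=
          setLIntegral_mono' measurableSet_Ioc hlow
      _ ≤ _ := lintegral_mono_set fun β hβ => by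
          have := hβ.1
          simp only [mem_Ioi]
          linarith
  refine le_trans (le_of_eq ?_) (mul_le_mul_right h3 (2 * 2 ^ q.toReal))
  have e1 : (2 : ℝ≥0∞) ^ q.toReal * ((2 : ℝ≥0∞) ^ q.toReal)⁻¹ = 1 :=
    ENNReal.mul_inv_cancel (by simp) (ENNReal.rpow_ne_top_of_nonneg hp.le (by simp))
  have e2 : 2 * ENNReal.ofReal (α / 2) = ENNReal.ofReal α := by
    rw [show (2 : ℝ≥0∞) = ENNReal.ofReal 2 by simp, ← ENNReal.ofReal_mul (by norm_num)]
    congr 1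
    ring
  have e3 : ENNReal.ofReal α * (ENNReal.ofReal α)⁻¹ = 1 :=
    ENNReal.mul_inv_cancel (by simpa using hα) ENNReal.ofReal_ne_top
  calc levelFun κ D α ^ q.toReal
      = levelFun κ D α ^ q.toReal * ((2 : ℝ≥0∞) ^ q.toReal * ((2 : ℝ≥0∞) ^ q.toReal)⁻¹)
        * (ENNReal.ofReal α * (ENNReal.ofReal α)⁻¹) := by rw [e1, e3, mul_one, mul_one]
    _ = _ := by rw [← e2]; ring

lemma weakNorm_le_mixNorm (hκ : 0 ≤ κ) (hD : Antitone D) {q : ℝ≥0∞} (hq1 : 1 ≤ q) :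
    weakNorm κ D ≤ embedConst q * mixNorm logMeasure q (levelFun κ D) :=
  iSup_le (levelFun_le_mixNorm hκ hD hq1)

lemma mixNorm_levelFun_le (hκ : 0 ≤ κ) (hD : Antitone D) {q q' : ℝ≥0∞} (hq1 : 1 ≤ q)
    (hqq' : q ≤ q') :
    mixNorm logMeasure q' (levelFun κ D) ≤ embedConst q * mixNorm logMeasure q (levelFun κ D) :=
  mixNorm_le_of_le hq1 hqq' (measurable_levelFun hD) (one_le_embedConst q)
    (levelFun_le_mixNorm hκ hD hq1)

end LevelFun

/-! ### Interpolation between weak-type bounds -/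

lemma lintegral_Ioc_rpow {a c : ℝ} (ha : 0 < a) (hc : c < 1) :
    ∫⁻ t in Ioc 0 a, ENNReal.ofReal (t ^ (-c)) = ENNReal.ofReal (a ^ (1 - c) / (1 - c)) := by
  have hi : IntervalIntegrable (fun t : ℝ => t ^ (-c)) volume 0 a :=
    intervalIntegral.intervalIntegrable_rpow' (by linarith)
  rw [← ofReal_integral_eq_lintegral_ofReal
    ((intervalIntegrable_iff_integrableOn_Ioc_of_le ha.le).1 hi)]
  · rw [← intervalIntegral.integral_of_le ha.le, integral_rpow (Or.inl (by linarith)),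
      show -c + 1 = 1 - c by ring, Real.zero_rpow (by linarith), sub_zero]
  · filter_upwards [self_mem_ae_restrict measurableSet_Ioc] with t ht
    exact Real.rpow_nonneg ht.1.le _

lemma lintegral_Ioi_rpow {a c : ℝ} (ha : 0 < a) (hc : 1 < c) :
    ∫⁻ t in Ioi a, ENNReal.ofReal (t ^ (-c)) = ENNReal.ofReal (a ^ (1 - c) / (c - 1)) := by
  rw [← ofReal_integral_eq_lintegral_ofReal (integrableOn_Ioi_rpow_of_lt (by linarith) ha)]
  · rw [integral_Ioi_rpow_of_lt (by linarith) ha, show -c + 1 = -(c - 1) by ring, neg_div_neg_eq,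
      show 1 - c = -(c - 1) by ring]
  · filter_upwards [self_mem_ae_restrict measurableSet_Ioi] with t ht
    exact Real.rpow_nonneg (ha.trans ht).le _

/-- A weak-type bound controls the distribution function by a power of the level. -/
lemma rpow_le_of_levelFun_le {κ₁ κ a t : ℝ} (hκ₁ : 0 < κ₁) (hκ : 0 ≤ κ) (ha : 0 ≤ a) (ht : 0 < t)
    {D : ℝ → ℝ≥0∞} (h : levelFun κ₁ D t ≤ ENNReal.ofReal a) :
    D t ^ κ ≤ ENNReal.ofReal (a ^ (κ / κ₁)) * ENNReal.ofReal (t ^ (-(κ / κ₁))) := by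
  rw [levelFun_of_pos hκ₁] at h
  have h1 : D t ^ κ₁ ≤ ENNReal.ofReal (a * t⁻¹) := by
    rw [ENNReal.ofReal_mul ha, ENNReal.ofReal_inv_of_pos ht, ← div_eq_mul_inv]
    rw [ENNReal.le_div_iff_mul_le (Or.inl (by simpa using ht)) (Or.inl ENNReal.ofReal_ne_top),
      mul_comm]
    exact h
  have h2 : D t ^ κ = (D t ^ κ₁) ^ (κ / κ₁) := by
    rw [← ENNReal.rpow_mul, mul_div_cancel₀ _ hκ₁.ne']
  rw [h2, ← ENNReal.ofReal_mul (Real.rpow_nonneg ha _), Real.rpow_neg ht.le,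
    ← Real.inv_rpow ht.le, ← Real.mul_rpow ha (inv_nonneg.2 ht.le),
    ← ENNReal.ofReal_rpow_of_nonneg (by positivity) (by positivity)]
  gcongr

lemma mixNorm_one_levelFun (κ : ℝ) (D : ℝ → ℝ≥0∞) :
    mixNorm logMeasure 1 (levelFun κ D)
      = ∫⁻ α in Ioi (0 : ℝ), if D α = 0 then 0 else D α ^ κ := by
  rw [mixNorm_of_ne_top ENNReal.one_ne_top]
  simp only [ENNReal.toReal_one, ENNReal.rpow_one, div_one]
  rw [lintegral_logMeasure]
  refine setLIntegral_congr_fun measurableSet_Ioi fun α hα => ?_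
  have h0 : ENNReal.ofReal α ≠ 0 := by simpa using hα
  simp only [levelFun]
  rw [mul_comm, ENNReal.mul_div_cancel_right h0 ENNReal.ofReal_ne_top]

/-- Splitting level for the interpolation between weak-type bounds. -/
lemma exists_split_level {κ₁ κ₂ θ a₁ a₂ : ℝ} (h : κ₁ < κ₂) (hκ₁ : 0 ≤ κ₁)
    (ha₁ : 0 < a₁) (ha₂ : 0 < a₂) :
    ∃ b : ℝ, 0 < b ∧
      a₂ ^ (((1 - θ) * κ₁ + θ * κ₂) / κ₂) * b ^ (1 - ((1 - θ) * κ₁ + θ * κ₂) / κ₂)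
        = a₁ ^ (1 - θ) * a₂ ^ θ ∧
      (κ₁ = 0 → b = a₁) ∧
      (0 < κ₁ → a₁ ^ (((1 - θ) * κ₁ + θ * κ₂) / κ₁) * b ^ (1 - ((1 - θ) * κ₁ + θ * κ₂) / κ₁)
        = a₁ ^ (1 - θ) * a₂ ^ θ) := by
  obtain ⟨x, rfl⟩ : ∃ x, a₁ = Real.exp x := ⟨_, (Real.exp_log ha₁).symm⟩
  obtain ⟨y, rfl⟩ : ∃ y, a₂ = Real.exp y := ⟨_, (Real.exp_log ha₂).symm⟩
  have hd : κ₂ - κ₁ ≠ 0 := by linarith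
  have hκ₂ : κ₂ ≠ 0 := by linarith
  -- The level at which the two bounds `D(b) ≤ (a_i/b)^{1/κ_i}` coincide, in logarithmic
  -- coordinates. For `κ₁ = 0` it reduces to `a₁`.
  refine ⟨Real.exp ((κ₂ * x - κ₁ * y) / (κ₂ - κ₁)), Real.exp_pos _, ?_, ?_, ?_⟩
  · simp only [← Real.exp_mul, ← Real.exp_add]
    congr 1
    field_simp
    ring
  · rintro rfl
    congr 1
    field_simp
    ring
  · intro hpos
    simp only [← Real.exp_mul, ← Real.exp_add]
    congr 1
    field_simp
    ring

/-- For `q = 1` the norm is `∫ D^κ dα`. Below the splitting level, the `κ₂` bound gives a power of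
`α` with exponent `-κ/κ₂ > -1`, integrable at zero. Above it, the `κ₁` bound gives exponent `-κ/κ₁ <
-1`, integrable at infinity. At the balancing level both pieces are multiples of the geometric mean.
-/
lemma mixNorm_one_le_of_lt {κ₁ κ₂ θ : ℝ} (hκ₁ : 0 ≤ κ₁) (h : κ₁ < κ₂) (hθ0 : 0 < θ) (hθ1 : θ < 1) :
    ∃ C : ℝ≥0∞, C ≠ ∞ ∧ ∀ D : ℝ → ℝ≥0∞, Antitone D →
      mixNorm logMeasure 1 (levelFun ((1 - θ) * κ₁ + θ * κ₂) D)
        ≤ C * (weakNorm κ₁ D ^ (1 - θ) * weakNorm κ₂ D ^ θ) := by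
  set κ := (1 - θ) * κ₁ + θ * κ₂ with hκ
  have hκ₂ : 0 < κ₂ := by linarith
  have hθ' : 0 < 1 - θ := by linarith
  have hκ0 : 0 < κ := by positivity
  have hc₂ : κ / κ₂ < 1 := by
    rw [div_lt_one hκ₂]
    nlinarith
  have hlt : κ₁ < κ := by nlinarith
  -- The summand `1` keeps `C` nonzero, so that `C * ∞ = ∞` when a weak norm is infinite. For `κ₁ =
  -- 0` the last term is `0`, since `κ / 0 = 0`.
  set C := 1 + ENNReal.ofReal (1 - κ / κ₂)⁻¹ + ENNReal.ofReal (κ / κ₁ - 1)⁻¹ with hC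
  have hCtop : C ≠ ∞ := by simp [hC]
  have hC0 : C ≠ 0 := by simp [hC]
  refine ⟨C, hCtop, fun D hD => ?_⟩
  by_cases hz : weakNorm κ₁ D = 0 ∨ weakNorm κ₂ D = 0
  · have hzero : ∀ α, levelFun κ D α = 0 := by
      intro α
      rcases hz with hz | hz
      · have := levelFun_rpow_mul_rpow (D := D) hκ₁ hκ₂.le hθ0 hθ1 α
        rw [hκ, this, le_antisymm ((levelFun_le_weakNorm α).trans_eq hz) zero_le,
          ENNReal.zero_rpow_of_pos hθ', zero_mul]
      · have := levelFun_rpow_mul_rpow (D := D) hκ₁ hκ₂.le hθ0 hθ1 α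
        rw [hκ, this, le_antisymm ((levelFun_le_weakNorm α).trans_eq hz) zero_le,
          ENNReal.zero_rpow_of_pos hθ0, mul_zero]
    rw [show levelFun κ D = fun _ => 0 from funext hzero, mixNorm_zero le_rfl]
    exact zero_le
  push Not at hz
  by_cases ht : weakNorm κ₁ D = ∞ ∨ weakNorm κ₂ D = ∞
  · have : weakNorm κ₁ D ^ (1 - θ) * weakNorm κ₂ D ^ θ = ∞ := by
      rw [ENNReal.mul_eq_top]
      rcases ht with ht | ht
      · right
        simp [ht, hz.2, hθ0, hθ1, hθ0.le]
      · left
        simp [ht, hz.1, hθ0, hθ1, hθ1.le]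
    rw [this, ENNReal.mul_top hC0]
    exact le_top
  push Not at ht
  obtain ⟨a₁, ha₁, e₁⟩ : ∃ a : ℝ, 0 < a ∧ weakNorm κ₁ D = ENNReal.ofReal a :=
    ⟨_, ENNReal.toReal_pos hz.1 ht.1, (ENNReal.ofReal_toReal ht.1).symm⟩
  obtain ⟨a₂, ha₂, e₂⟩ : ∃ a : ℝ, 0 < a ∧ weakNorm κ₂ D = ENNReal.ofReal a :=
    ⟨_, ENNReal.toReal_pos hz.2 ht.2, (ENNReal.ofReal_toReal ht.2).symm⟩
  obtain ⟨b, hb, hb₂, hb0, hb₁⟩ := exists_split_level (θ := θ) h hκ₁ ha₁ ha₂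
  rw [← hκ] at hb₂ hb₁
  set G := a₁ ^ (1 - θ) * a₂ ^ θ with hG
  have hG0 : 0 < G := by positivity
  have hGe : weakNorm κ₁ D ^ (1 - θ) * weakNorm κ₂ D ^ θ = ENNReal.ofReal G := by
    rw [e₁, e₂, ENNReal.ofReal_rpow_of_pos ha₁, ENNReal.ofReal_rpow_of_pos ha₂,
      ← ENNReal.ofReal_mul (by positivity)]
  rw [hGe, mixNorm_one_levelFun, ← Ioc_union_Ioi_eq_Ioi hb.le]
  refine (lintegral_union_le _ _ _).trans ?_
  have hlow : ∫⁻ α in Ioc 0 b, (if D α = 0 then 0 else D α ^ κ)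
      ≤ ENNReal.ofReal (1 - κ / κ₂)⁻¹ * ENNReal.ofReal G := by
    calc _ ≤ ∫⁻ α in Ioc 0 b,
          ENNReal.ofReal (a₂ ^ (κ / κ₂)) * ENNReal.ofReal (α ^ (-(κ / κ₂))) := by
          refine setLIntegral_mono' measurableSet_Ioc fun α hα => ?_
          split_ifs
          · exact zero_le
          · exact rpow_le_of_levelFun_le hκ₂ hκ0.le ha₂.le hα.1
              ((levelFun_le_weakNorm α).trans_eq e₂)
      _ = _ := by
          rw [lintegral_const_mul' _ _ ENNReal.ofReal_ne_top, lintegral_Ioc_rpow hb hc₂,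
            ← ENNReal.ofReal_mul (by positivity),
            ← ENNReal.ofReal_mul (inv_nonneg.2 (by linarith)), ← hb₂]
          congr 1
          ring
  have hhigh : ∫⁻ α in Ioi b, (if D α = 0 then 0 else D α ^ κ)
      ≤ ENNReal.ofReal (κ / κ₁ - 1)⁻¹ * ENNReal.ofReal G := by
    -- For `κ₁ = 0` the first weak norm is the essential supremum and `b = a₁`, so `D` vanishes
    -- beyond `b` and there is no tail.
    rcases hκ₁.eq_or_lt with h0 | hpos
    · have : ∫⁻ α in Ioi b, (if D α = 0 then 0 else D α ^ κ) = ∫⁻ α in Ioi b, 0 := by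
        refine setLIntegral_congr_fun measurableSet_Ioi fun α hα => ?_
        have hl := levelFun_le_weakNorm (κ := κ₁) (D := D) α
        rw [e₁, ← h0, levelFun, ENNReal.rpow_zero] at hl
        have hα' : a₁ < α := by rw [← hb0 h0.symm]; exact hα
        by_cases hDα : D α = 0
        · simp [hDα]
        · rw [if_neg hDα, mul_one, ENNReal.ofReal_le_ofReal_iff ha₁.le] at hl
          linarith
      rw [this, lintegral_zero]
      exact zero_le
    · have hc₁ : 1 < κ / κ₁ := by rwa [one_lt_div hpos]
      calc _ ≤ ∫⁻ α in Ioi b,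
            ENNReal.ofReal (a₁ ^ (κ / κ₁)) * ENNReal.ofReal (α ^ (-(κ / κ₁))) := by
            refine setLIntegral_mono' measurableSet_Ioi fun α hα => ?_
            split_ifs
            · exact zero_le
            · exact rpow_le_of_levelFun_le hpos hκ0.le ha₁.le (hb.trans hα)
                ((levelFun_le_weakNorm α).trans_eq e₁)
        _ = _ := by
            rw [lintegral_const_mul' _ _ ENNReal.ofReal_ne_top, lintegral_Ioi_rpow hb hc₁,
              ← ENNReal.ofReal_mul (by positivity),
              ← ENNReal.ofReal_mul (inv_nonneg.2 (by linarith)), ← hb₁ hpos]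
            congr 1
            ring
  calc _ ≤ ENNReal.ofReal (1 - κ / κ₂)⁻¹ * ENNReal.ofReal G
        + ENNReal.ofReal (κ / κ₁ - 1)⁻¹ * ENNReal.ofReal G := add_le_add hlow hhigh
    _ ≤ C * ENNReal.ofReal G := by
        rw [← add_mul, hC, add_assoc]
        exact mul_le_mul' le_add_self le_rfl

/-- Two weak-type bounds with different exponents give strong bounds in between. -/
lemma mixNorm_levelFun_le_weakNorm {κ₁ κ₂ θ : ℝ} (hκ₁ : 0 ≤ κ₁) (hκ₂ : 0 ≤ κ₂) (h : κ₁ ≠ κ₂)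
    (hθ0 : 0 < θ) (hθ1 : θ < 1) {q : ℝ≥0∞} (hq : 1 ≤ q) :
    ∃ C : ℝ≥0∞, C ≠ ∞ ∧ ∀ D : ℝ → ℝ≥0∞, Antitone D →
      mixNorm logMeasure q (levelFun ((1 - θ) * κ₁ + θ * κ₂) D)
        ≤ C * (weakNorm κ₁ D ^ (1 - θ) * weakNorm κ₂ D ^ θ) := by
  obtain ⟨C, hC, hCD⟩ : ∃ C : ℝ≥0∞, C ≠ ∞ ∧ ∀ D : ℝ → ℝ≥0∞, Antitone D →
      mixNorm logMeasure 1 (levelFun ((1 - θ) * κ₁ + θ * κ₂) D)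
        ≤ C * (weakNorm κ₁ D ^ (1 - θ) * weakNorm κ₂ D ^ θ) := by
    rcases h.lt_or_gt with h | h
    · exact mixNorm_one_le_of_lt hκ₁ h hθ0 hθ1
    · obtain ⟨C, hC, hCD⟩ := mixNorm_one_le_of_lt (θ := 1 - θ) hκ₂ h (by linarith) (by linarith)
      refine ⟨C, hC, fun D hD => ?_⟩
      have := hCD D hD
      rwa [sub_sub_cancel, add_comm (θ * κ₂), mul_comm (weakNorm κ₂ D ^ θ)] at this
  refine ⟨embedConst 1 * C, ENNReal.mul_ne_top (embedConst_ne_top 1) hC, fun D hD => ?_⟩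
  have hθ' : 0 < 1 - θ := by linarith
  calc _ ≤ embedConst 1 * _ := mixNorm_levelFun_le (by positivity) hD le_rfl hq
    _ ≤ embedConst 1 * (C * (weakNorm κ₁ D ^ (1 - θ) * weakNorm κ₂ D ^ θ)) := by
        gcongr
        exact hCD D hD
    _ = _ := (mul_assoc _ _ _).symm

/-! ### Geometric sums -/

lemma tsum_two_rpow_neg_abs_ne_top {ε : ℝ} (hε : 0 < ε) :
    ∑' k : ℤ, ENNReal.ofReal ((2 : ℝ) ^ (-(|(k : ℝ)| * ε))) ≠ ∞ := by
  have hs : Summable fun k : ℤ => (2 : ℝ) ^ (-(|(k : ℝ)| * ε)) := by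
    have hg : Summable fun m : ℕ => ((2 : ℝ) ^ (-ε)) ^ m :=
      summable_geometric_of_lt_one (by positivity)
        (Real.rpow_lt_one_of_one_lt_of_neg one_lt_two (by linarith))
    have hg' : Summable fun m : ℕ => (2 : ℝ) ^ (-((m : ℝ) * ε)) := by
      refine hg.congr fun m => ?_
      rw [← Real.rpow_natCast, ← Real.rpow_mul (by norm_num)]
      congr 1
      ring
    rw [summable_int_iff_summable_nat_and_neg]
    constructor
    · simpa using hg'
    · simpa using hg'
  rw [← ENNReal.ofReal_tsum_of_nonneg (fun k => by positivity) hs]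
  exact ENNReal.ofReal_ne_top

/-- A sequence which is bounded by a growing and by a decaying geometric sequence is summable, and
its sum is bounded by the corresponding geometric mean. -/
lemma tsum_le_of_two_sided {θ d : ℝ} (hθ0 : 0 < θ) (hθ1 : θ < 1) (hd : d ≠ 0) :
    ∃ C : ℝ≥0∞, C ≠ ∞ ∧ ∀ (b : ℤ → ℝ≥0∞) (A₁ A₂ : ℝ≥0∞),
      (∀ j : ℤ, b j ≤ ENNReal.ofReal ((2 : ℝ) ^ ((j : ℝ) * (θ * d))) * A₁) →
      (∀ j : ℤ, b j ≤ ENNReal.ofReal ((2 : ℝ) ^ (-((j : ℝ) * ((1 - θ) * d)))) * A₂) →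
      ∑' j, b j ≤ C * (A₁ ^ (1 - θ) * A₂ ^ θ) := by
  have hθ' : 0 < 1 - θ := by linarith
  set ε := min θ (1 - θ) * |d| with hε
  have hε0 : 0 < ε := mul_pos (lt_min hθ0 hθ') (abs_pos.2 hd)
  set S := ∑' k : ℤ, ENNReal.ofReal ((2 : ℝ) ^ (-(|(k : ℝ)| * ε))) with hS
  have hStop : S ≠ ∞ := tsum_two_rpow_neg_abs_ne_top hε0
  -- `2^ε` pays for rounding the crossing point to an integer. The summand `1` makes the constant
  -- visibly nonzero when the right side is infinite.
  refine ⟨1 + ENNReal.ofReal ((2 : ℝ) ^ ε) * S,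
    ENNReal.add_ne_top.2 ⟨by simp, ENNReal.mul_ne_top ENNReal.ofReal_ne_top hStop⟩,
    fun b A₁ A₂ h₁ h₂ => ?_⟩
  by_cases hz : A₁ = 0 ∨ A₂ = 0
  · have : ∀ j, b j = 0 := by
      intro j
      rcases hz with hz | hz
      · simpa [hz] using h₁ j
      · simpa [hz] using h₂ j
    simp [this]
  push Not at hz
  by_cases ht : A₁ = ∞ ∨ A₂ = ∞
  · have : A₁ ^ (1 - θ) * A₂ ^ θ = ∞ := by
      rw [ENNReal.mul_eq_top]
      rcases ht with ht | ht
      · right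
        simp [ht, hz.2, hθ0, hθ1, hθ0.le]
      · left
        simp [ht, hz.1, hθ0, hθ1, hθ1.le]
    rw [this, ENNReal.mul_top (by simp)]
    exact le_top
  push Not at ht
  obtain ⟨x, e₁⟩ : ∃ x : ℝ, A₁ = ENNReal.ofReal (2 ^ x) := by
    refine ⟨Real.logb 2 A₁.toReal, ?_⟩
    rw [Real.rpow_logb two_pos (by norm_num) (ENNReal.toReal_pos hz.1 ht.1),
      ENNReal.ofReal_toReal ht.1]
  obtain ⟨y, e₂⟩ : ∃ x : ℝ, A₂ = ENNReal.ofReal (2 ^ x) := by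
    refine ⟨Real.logb 2 A₂.toReal, ?_⟩
    rw [Real.rpow_logb two_pos (by norm_num) (ENNReal.toReal_pos hz.2 ht.2),
      ENNReal.ofReal_toReal ht.2]
  have hGe : A₁ ^ (1 - θ) * A₂ ^ θ = ENNReal.ofReal ((2 : ℝ) ^ ((1 - θ) * x + θ * y)) := by
    rw [e₁, e₂, ENNReal.ofReal_rpow_of_pos (by positivity),
      ENNReal.ofReal_rpow_of_pos (by positivity), ← ENNReal.ofReal_mul (by positivity),
      ← Real.rpow_mul two_pos.le, ← Real.rpow_mul two_pos.le, ← Real.rpow_add two_pos]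
    ring_nf
  -- The real index at which the two geometric bounds cross. Their common value there is `A₁^(1-θ) *
  -- A₂^θ`, and away from `ρ` the better of the two decays at least like `2^(-ε|j-ρ|)`.
  set ρ := (y - x) / d with hρ
  have hρd : ρ * d = y - x := div_mul_cancel₀ _ hd
  set J := ⌊ρ⌋ with hJ
  have hb : ∀ j : ℤ, b j ≤ ENNReal.ofReal ((2 : ℝ) ^ ε) * (A₁ ^ (1 - θ) * A₂ ^ θ)
      * ENNReal.ofReal ((2 : ℝ) ^ (-(|((j - J : ℤ) : ℝ)| * ε))) := by
    intro j
    have habs : |((j - J : ℤ) : ℝ)| ≤ |(j : ℝ) - ρ| + 1 := by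
      have hf1 := Int.floor_le ρ
      have hf2 := Int.lt_floor_add_one ρ
      rw [← hJ] at hf1 hf2
      push_cast
      calc |(j : ℝ) - J| = |((j : ℝ) - ρ) + (ρ - J)| := by congr 1; ring
        _ ≤ |(j : ℝ) - ρ| + |ρ - J| := abs_add_le _ _
        _ ≤ _ := by
          gcongr
          rw [abs_le]
          constructor <;> linarith
    have hexp : -(|(j : ℝ) - ρ| * ε) ≤ ε + -(|((j - J : ℤ) : ℝ)| * ε) := by nlinarith
    have hmain : b j ≤ ENNReal.ofReal ((2 : ℝ) ^ ((1 - θ) * x + θ * y + -(|(j : ℝ) - ρ| * ε))) := by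
      have hm1 : min θ (1 - θ) ≤ θ := min_le_left _ _
      have hm2 : min θ (1 - θ) ≤ 1 - θ := min_le_right _ _
      have hprod : |(j : ℝ) - ρ| * ε = min θ (1 - θ) * |((j : ℝ) - ρ) * d| := by
        rw [abs_mul, hε]; ring
      have hjd : ((j : ℝ) - ρ) * d = j * d - (y - x) := by rw [sub_mul, hρd]
      rw [hprod, hjd]
      have habs0 := abs_nonneg ((j : ℝ) * d - (y - x))
      rcases le_or_gt ((j : ℝ) * d - (y - x)) 0 with hs | hs
      · refine (h₁ j).trans ?_
        rw [e₁, ← ENNReal.ofReal_mul (by positivity), ← Real.rpow_add two_pos]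
        apply ENNReal.ofReal_le_ofReal
        apply Real.rpow_le_rpow_of_exponent_le one_le_two
        have := mul_le_mul_of_nonneg_right hm1 habs0
        rw [abs_of_nonpos hs] at this ⊢
        linarith
      · refine (h₂ j).trans ?_
        rw [e₂, ← ENNReal.ofReal_mul (by positivity), ← Real.rpow_add two_pos]
        apply ENNReal.ofReal_le_ofReal
        apply Real.rpow_le_rpow_of_exponent_le one_le_two
        have := mul_le_mul_of_nonneg_right hm2 habs0
        rw [abs_of_pos hs] at this ⊢
        linarith
    refine hmain.trans ?_
    rw [hGe, ← ENNReal.ofReal_mul (by positivity), ← ENNReal.ofReal_mul (by positivity),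
      ← Real.rpow_add two_pos, ← Real.rpow_add two_pos]
    apply ENNReal.ofReal_le_ofReal
    apply Real.rpow_le_rpow_of_exponent_le one_le_two
    linarith
  have hshift : ∑' j : ℤ, ENNReal.ofReal ((2 : ℝ) ^ (-(|((j - J : ℤ) : ℝ)| * ε))) = S :=
    (Equiv.subRight J).tsum_eq fun k : ℤ => ENNReal.ofReal ((2 : ℝ) ^ (-(|(k : ℝ)| * ε)))
  calc ∑' j, b j ≤ _ := ENNReal.tsum_le_tsum hb
    _ = ENNReal.ofReal ((2 : ℝ) ^ ε) * S * (A₁ ^ (1 - θ) * A₂ ^ θ) := by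
        rw [ENNReal.tsum_mul_left, hshift]
        ring
    _ ≤ _ := by
        gcongr
        exact le_add_self

/-! ### A Nikolskii type inequality for functions with a reproducing kernel -/

/-- Where `|u| ≤ l` the convolution contributes at most `K₁ l`. The set `|u| > l` has measure at
most `1/(2K')`, so it contributes at most half the supremum, which is absorbed on the left.
Absorption needs a finite supremum, so it is carried out for `u` divided by a polynomial weight. -/
lemma norm_le_of_reproducing {n : ℕ} {u K : E n → ℂ} (hu : Continuous u) (hK : Continuous K)
    {N : ℕ} {B K₁ K' l : ℝ} (hB : 0 ≤ B) (hK₁ : 0 ≤ K₁) (hl : 0 ≤ l)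
    (hgrowth : ∀ x, ‖u x‖ ≤ B * (1 + ‖x‖) ^ N)
    (hrep : ∀ x, u x = ∫ w, K w * u (x - w))
    (hK1 : ∫⁻ w, ‖K w‖ₑ ≤ ENNReal.ofReal K₁)
    (hK' : ∀ w, ‖K w‖ * (1 + ‖w‖) ^ N ≤ K')
    (hD : ENNReal.ofReal K' * distribFun u l ≤ ENNReal.ofReal (1 / 2)) (x : E n) :
    ‖u x‖ ≤ 2 * K₁ * l := by
  have hK'0 : 0 ≤ K' := le_trans (by positivity) (hK' 0)
  -- The weight `(1 + ε‖y‖)^N` makes the supremum finite by polynomial growth. For `ε ≤ 1` its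
  -- quotient under a shift by `w` is at most `(1 + ‖w‖)^N`, which the kernel bound `K'` controls.
  -- The resulting estimate is uniform in `ε`, and `ε → 0` removes the weight.
  have weighted : ∀ ε : ℝ, 0 < ε → ε ≤ 1 → ∀ y, ‖u y‖ ≤ 2 * K₁ * l * (1 + ε * ‖y‖) ^ N := by
    intro ε hε hε1
    set M : E n → ℝ := fun y => ‖u y‖ / (1 + ε * ‖y‖) ^ N with hM
    have hM0 : ∀ y, 0 ≤ M y := fun y => by positivity
    have hbdd : BddAbove (range M) := by
      refine ⟨B * (ε⁻¹) ^ N, ?_⟩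
      rintro _ ⟨y, rfl⟩
      rw [hM]
      simp only
      rw [div_le_iff₀ (by positivity), mul_assoc, ← mul_pow]
      refine (hgrowth y).trans ?_
      gcongr
      rw [mul_add, mul_one, inv_mul_cancel_left₀ hε.ne']
      gcongr
      exact (one_le_inv₀ hε).2 hε1
    set S := ⨆ y, M y with hS
    have hMS : ∀ y, M y ≤ S := le_ciSup hbdd
    have hS0 : 0 ≤ S := (hM0 0).trans (hMS 0)
    have huM : ∀ y, ‖u y‖ = M y * (1 + ε * ‖y‖) ^ N := fun y => by
      rw [hM]; simp only; field_simp
    have hstep : ∀ y, M y ≤ K₁ * l + S / 2 := by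
      intro y
      have hpt : ∀ w, ‖K w‖ₑ * ‖u (y - w)‖ₑ / ENNReal.ofReal ((1 + ε * ‖y‖) ^ N) ≤
          ‖K w‖ₑ * ENNReal.ofReal l + ENNReal.ofReal K' * ENNReal.ofReal S *
            {w | l < ‖u (y - w)‖}.indicator 1 w := by
        intro w
        have hone : 1 ≤ (1 + ε * ‖y‖) ^ N := one_le_pow₀ (le_add_of_nonneg_right (by positivity))
        by_cases hw : l < ‖u (y - w)‖
        · rw [indicator_of_mem (by exact hw), Pi.one_apply, mul_one]
          refine le_trans ?_ le_add_self
          refine ENNReal.div_le_of_le_mul ?_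
          rw [← ofReal_norm, ← ofReal_norm, ← ENNReal.ofReal_mul (by positivity),
            ← ENNReal.ofReal_mul (by positivity), ← ENNReal.ofReal_mul (by positivity)]
          apply ENNReal.ofReal_le_ofReal
          have hsub : 1 + ε * ‖y - w‖ ≤ (1 + ‖w‖) * (1 + ε * ‖y‖) := by
            have h1 : ‖y - w‖ ≤ ‖y‖ + ‖w‖ := norm_sub_le y w
            have h2 : ε * ‖w‖ ≤ ‖w‖ := mul_le_of_le_one_left (norm_nonneg w) hε1
            have h3 : 0 ≤ ‖w‖ * (ε * ‖y‖) := by positivity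
            nlinarith
          calc ‖K w‖ * ‖u (y - w)‖ ≤ ‖K w‖ * (S * ((1 + ‖w‖) * (1 + ε * ‖y‖)) ^ N) := by
                rw [huM (y - w)]
                gcongr
                exact hMS _
            _ = ‖K w‖ * (1 + ‖w‖) ^ N * S * (1 + ε * ‖y‖) ^ N := by rw [mul_pow]; ring
            _ ≤ _ := by
                gcongr
                exact hK' w
        · refine le_trans ?_ le_self_add
          refine ENNReal.div_le_of_le_mul ?_
          rw [mul_assoc]
          gcongr
          rw [← ofReal_norm, ← ENNReal.ofReal_mul hl]
          apply ENNReal.ofReal_le_ofReal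
          exact (not_lt.1 hw).trans (le_mul_of_one_le_right hl hone)
      have hmeas : MeasurableSet {w | l < ‖u (y - w)‖} :=
        (isOpen_lt continuous_const (by fun_prop)).measurableSet
      have hvol : volume {w | l < ‖u (y - w)‖} = distribFun u l := by
        have : {w | l < ‖u (y - w)‖} = (fun w => y - w) ⁻¹' {w | l < ‖u w‖} := rfl
        rw [this, distribFun]
        exact (Measure.measurePreserving_sub_left volume y).measure_preimage
          (isOpen_lt continuous_const (by fun_prop)).measurableSet.nullMeasurableSet
      have hint : ENNReal.ofReal (M y) ≤ ENNReal.ofReal (K₁ * l + S / 2) := by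
        rw [hM]
        simp only
        rw [ENNReal.ofReal_div_of_pos (by positivity), ofReal_norm, hrep y]
        calc _ ≤ (∫⁻ w, ‖K w‖ₑ * ‖u (y - w)‖ₑ) / ENNReal.ofReal ((1 + ε * ‖y‖) ^ N) := by
              gcongr
              refine (enorm_integral_le_lintegral_enorm _).trans_eq ?_
              simp only [enorm_mul]
          _ = ∫⁻ w, ‖K w‖ₑ * ‖u (y - w)‖ₑ / ENNReal.ofReal ((1 + ε * ‖y‖) ^ N) := by
              simp only [div_eq_mul_inv]
              rw [lintegral_mul_const' _ _ (by simp; positivity)]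
          _ ≤ ∫⁻ w, (‖K w‖ₑ * ENNReal.ofReal l + ENNReal.ofReal K' * ENNReal.ofReal S *
                {w | l < ‖u (y - w)‖}.indicator 1 w) := lintegral_mono hpt
          _ = (∫⁻ w, ‖K w‖ₑ) * ENNReal.ofReal l
              + ENNReal.ofReal K' * ENNReal.ofReal S * distribFun u l := by
              rw [lintegral_add_left (by fun_prop), lintegral_mul_const' _ _ ENNReal.ofReal_ne_top,
                lintegral_const_mul' _ _ (ENNReal.mul_ne_top ENNReal.ofReal_ne_top
                  ENNReal.ofReal_ne_top), lintegral_indicator_one hmeas, hvol]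
          _ ≤ ENNReal.ofReal K₁ * ENNReal.ofReal l
              + ENNReal.ofReal (1 / 2) * ENNReal.ofReal S := by
              rw [mul_right_comm]
              gcongr
          _ = _ := by
              rw [← ENNReal.ofReal_mul hK₁, ← ENNReal.ofReal_mul (by norm_num),
                ← ENNReal.ofReal_add (by positivity) (by positivity)]
              ring_nf
      exact (ENNReal.ofReal_le_ofReal_iff (by positivity)).1 hint
    have hSle : S ≤ 2 * K₁ * l := by
      have : S ≤ K₁ * l + S / 2 := ciSup_le hstep
      linarith
    intro y
    rw [huM y]
    gcongr
    exact (hMS y).trans hSle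
  have hlim : Filter.Tendsto (fun ε : ℝ => 2 * K₁ * l * (1 + ε * ‖x‖) ^ N) (nhdsWithin 0 (Ioi 0))
      (nhds (2 * K₁ * l)) := by
    have : Continuous fun ε : ℝ => 2 * K₁ * l * (1 + ε * ‖x‖) ^ N := by fun_prop
    simpa using (this.tendsto 0).mono_left (nhdsWithin_le_nhds (s := Ioi 0))
  refine ge_of_tendsto hlim ?_
  filter_upwards [Ioc_mem_nhdsGT (zero_lt_one' ℝ)] with ε hε
  exact weighted ε hε.1 hε.2 x

/-- A function of polynomial growth in weak `L^p` which is reproduced by a rapidly decreasing kernel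
is bounded. -/
lemma weakNorm_zero_le_of_reproducing {n : ℕ} {u K : E n → ℂ} (hu : Continuous u)
    (hK : Continuous K) {N : ℕ} {B K₁ K₀ K' κ : ℝ} (hB : 0 ≤ B) (hK₁ : 0 < K₁) (hK₀ : 0 < K₀)
    (hκ : 0 < κ)
    (hgrowth : ∀ x, ‖u x‖ ≤ B * (1 + ‖x‖) ^ N)
    (hrep : ∀ x, u x = ∫ w, K w * u (x - w))
    (hK1 : ∫⁻ w, ‖K w‖ₑ ≤ ENNReal.ofReal K₁)
    (hK0 : ∀ w, ‖K w‖ ≤ K₀)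
    (hK' : ∀ w, ‖K w‖ * (1 + ‖w‖) ^ N ≤ K') :
    weakNorm 0 (distribFun u)
      ≤ ENNReal.ofReal (2 * K₁ * (2 * K₀) ^ κ) * weakNorm κ (distribFun u) := by
  have hc : 0 < 2 * K₁ * (2 * K₀) ^ κ := by positivity
  by_cases ht : weakNorm κ (distribFun u) = ∞
  · rw [ht, ENNReal.mul_top (by simpa using hc)]
    exact le_top
  set a := (weakNorm κ (distribFun u)).toReal with ha
  have ha0 : 0 ≤ a := ENNReal.toReal_nonneg
  have hae : weakNorm κ (distribFun u) = ENNReal.ofReal a := (ENNReal.ofReal_toReal ht).symm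
  -- The weak bound gives `D(l) ≤ (a/l)^(1/κ)`. The threshold `a (2L)^κ` is where `L` times this
  -- equals `1/2`.
  have small : ∀ L : ℝ, 0 < L → ∀ l : ℝ, 0 < l → a * (2 * L) ^ κ ≤ l →
      ENNReal.ofReal L * distribFun u l ≤ ENNReal.ofReal (1 / 2) := by
    intro L hL l hl hle
    have h := rpow_le_of_levelFun_le (κ := 1) hκ zero_le_one ha0 hl
      ((levelFun_le_weakNorm l).trans_eq hae)
    rw [ENNReal.rpow_one, ← ENNReal.ofReal_mul (by positivity)] at h
    calc _ ≤ ENNReal.ofReal L * ENNReal.ofReal (a ^ (1 / κ) * l ^ (-(1 / κ))) := by gcongr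
      _ ≤ ENNReal.ofReal (1 / 2) := by
        rw [← ENNReal.ofReal_mul hL.le]
        apply ENNReal.ofReal_le_ofReal
        have h1 : (a * (2 * L) ^ κ) ^ (1 / κ) ≤ l ^ (1 / κ) := by gcongr
        rw [Real.mul_rpow ha0 (by positivity), ← Real.rpow_mul (by positivity),
          mul_one_div_cancel hκ.ne', Real.rpow_one] at h1
        have hlp : 0 < l ^ (1 / κ) := by positivity
        rw [Real.rpow_neg hl.le, ← div_eq_mul_inv, ← mul_div_assoc, div_le_iff₀ hlp]
        linarith
  have hK'pos : 0 < max K' 1 := lt_max_of_lt_right one_pos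
  set l' := a * (2 * max K' 1) ^ κ + 1 with hl'
  have hl'0 : 0 < l' := by positivity
  -- This first pass only shows that `u` is bounded: its constant depends on the growth exponent `N`
  -- through `K'`.
  have hbdd := norm_le_of_reproducing hu hK hB hK₁.le hl'0.le hgrowth hrep hK1
    (fun w => (hK' w).trans (le_max_left _ _)) (small _ hK'pos l' hl'0 (by linarith))
  have hfinal : ∀ l : ℝ, a * (2 * K₀) ^ κ < l → ∀ x, ‖u x‖ ≤ 2 * K₁ * l := by
    intro l hl
    have hl0 : 0 < l := lt_of_le_of_lt (by positivity) hl
    -- Once `u` is bounded, `N = 0` is admissible and `K'` is replaced by the sup norm `K₀` of the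
    -- kernel. This removes the dependence on the growth of `u`.
    exact norm_le_of_reproducing (N := 0) (B := 2 * K₁ * l') hu hK (by positivity) hK₁.le hl0.le
      (by simpa using hbdd) hrep hK1 (by simpa using hK0) (small _ hK₀ l hl0 hl.le)
  have hfinal' : ∀ x, ‖u x‖ ≤ 2 * K₁ * (a * (2 * K₀) ^ κ) := by
    intro x
    have : ‖u x‖ / (2 * K₁) ≤ a * (2 * K₀) ^ κ := by
      refine le_of_forall_gt_imp_ge_of_dense fun l hl => ?_
      rw [div_le_iff₀ (by positivity), mul_comm]
      exact hfinal l hl x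
    rwa [div_le_iff₀ (by positivity), mul_comm] at this
  rw [hae, ← ENNReal.ofReal_mul hc.le]
  refine iSup_le fun α => ?_
  unfold levelFun
  split_ifs with h
  · simp
  · rw [ENNReal.rpow_zero, mul_one]
    apply ENNReal.ofReal_le_ofReal
    obtain ⟨x, hx⟩ : {x | α < ‖u x‖}.Nonempty := nonempty_of_measure_ne_zero h
    calc α ≤ ‖u x‖ := le_of_lt hx
      _ ≤ _ := hfinal' x
      _ = _ := by ring

/-! ### Reproducing kernels at dyadic scales -/

lemma exists_dilated_cutoff {n : ℕ} (χ : 𝓢(E n, ℂ)) (hχ : HasCompactSupport χ) {c : ℝ} (hc : 0 < c) :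
    ∃ η : 𝓢(E n, ℂ), (∀ ξ, η ξ = χ (c • ξ)) ∧
      ∀ w, (𝓕 η : 𝓢(E n, ℂ)) w = ((c ^ n)⁻¹ : ℝ) • (𝓕 χ : 𝓢(E n, ℂ)) (c⁻¹ • w) := by
  have hs : HasCompactSupport fun ξ => χ (c • ξ) := hχ.comp_smul hc.ne'
  have hd : ContDiff ℝ (⊤ : ℕ∞) fun ξ => χ (c • ξ) :=
    (χ.smooth ⊤).comp (contDiff_const_smul c)
  refine ⟨hs.toSchwartzMap hd, fun ξ => rfl, fun w => ?_⟩
  rw [SchwartzMap.fourier_coe, SchwartzMap.fourier_coe, Real.fourier_eq, Real.fourier_eq]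
  have := Measure.integral_comp_smul (volume : Measure (E n))
    (fun v => Real.fourierChar (-(inner ℝ v (c⁻¹ • w))) • χ v) c
  simp only [finrank_euclideanSpace, Fintype.card_fin] at this
  rw [abs_of_pos (by positivity)] at this
  rw [← this]
  congr 1
  ext v
  rw [real_inner_smul_left, real_inner_smul_right, mul_inv_cancel_left₀ hc.ne']
  rfl

/-- All cutoffs are dilates of one bump. The `L¹` norm of the Fourier transform is invariant under
dilation, while its sup norm scales like `2^{jn}`, the only source of the scale factor in
Nikolskii's inequality. -/
lemma exists_dyadic_cutoff (n : ℕ) :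
    ∃ K₁ K₀ : ℝ, 0 < K₁ ∧ 0 < K₀ ∧ ∀ j : ℤ, ∃ χ : 𝓢(E n, ℂ),
      (∀ ξ, ‖ξ‖ ≤ (2 : ℝ) ^ (j + 1) → χ ξ = 1) ∧
      ∫⁻ w, ‖(𝓕 χ : 𝓢(E n, ℂ)) w‖ₑ ≤ ENNReal.ofReal K₁ ∧
      ∀ w, ‖(𝓕 χ : 𝓢(E n, ℂ)) w‖ ≤ K₀ * (2 : ℝ) ^ ((j : ℝ) * n) := by
  -- Equal to one on the ball of radius `2`, so that its dilate by `2^(-j)` is one up to radius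
  -- `2^(j+1)`.
  let β : ContDiffBump (0 : E n) := ⟨2, 3, two_pos, by norm_num⟩
  have hs : HasCompactSupport fun ξ : E n => ((β ξ : ℝ) : ℂ) :=
    β.hasCompactSupport.comp_left (g := fun t : ℝ => (t : ℂ)) Complex.ofReal_zero
  have hd : ContDiff ℝ (⊤ : ℕ∞) fun ξ : E n => ((β ξ : ℝ) : ℂ) :=
    Complex.ofRealCLM.contDiff.comp β.contDiff
  set χ : 𝓢(E n, ℂ) := hs.toSchwartzMap hd with hχ
  have hχs : HasCompactSupport χ := hs
  have hχ1 : ∀ ξ, ‖ξ‖ ≤ 2 → χ ξ = 1 := by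
    intro ξ hξ
    have : β ξ = 1 := β.one_of_mem_closedBall (by simpa using hξ)
    change ((β ξ : ℝ) : ℂ) = 1
    rw [this, Complex.ofReal_one]
  set K : 𝓢(E n, ℂ) := 𝓕 χ with hK
  refine ⟨(∫ w, ‖K w‖) + 1, SchwartzMap.seminorm ℝ 0 0 K + 1, by positivity, by positivity,
    fun j => ?_⟩
  have hc : (0 : ℝ) < 2 ^ (-j) := by positivity
  obtain ⟨η, hη, hFη⟩ := exists_dilated_cutoff χ hχs hc
  have hinv : (((2 : ℝ) ^ (-j)) ^ n)⁻¹ = (2 : ℝ) ^ ((j : ℝ) * n) := by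
    rw [Real.rpow_mul two_pos.le, Real.rpow_intCast, Real.rpow_natCast, zpow_neg, inv_pow, inv_inv]
  refine ⟨η, fun ξ hξ => ?_, ?_, fun w => ?_⟩
  · rw [hη]
    apply hχ1
    rw [norm_smul, Real.norm_of_nonneg hc.le]
    calc (2 : ℝ) ^ (-j) * ‖ξ‖ ≤ 2 ^ (-j) * 2 ^ (j + 1) := by gcongr
      _ = 2 := by
        rw [← zpow_add₀ two_ne_zero]
        simp
  · rw [← ofReal_integral_norm_eq_lintegral_enorm (𝓕 η : 𝓢(E n, ℂ)).integrable]
    apply ENNReal.ofReal_le_ofReal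
    have h1 : ∀ w, ‖(𝓕 η : 𝓢(E n, ℂ)) w‖
        = (((2 : ℝ) ^ (-j)) ^ n)⁻¹ * ‖K (((2 : ℝ) ^ (-j))⁻¹ • w)‖ := by
      intro w
      rw [hFη, norm_smul, Real.norm_of_nonneg (by positivity)]
    simp_rw [h1]
    rw [integral_const_mul, Measure.integral_comp_smul volume (fun w => ‖K w‖)]
    simp only [finrank_euclideanSpace, Fintype.card_fin]
    rw [abs_of_pos (by positivity), smul_eq_mul, inv_pow, inv_inv, inv_mul_cancel_left₀]
    · linarith
    · positivity
  · rw [hFη, norm_smul, Real.norm_of_nonneg (by positivity), hinv, mul_comm]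
    gcongr
    exact (SchwartzMap.norm_le_seminorm ℝ K _).trans (by linarith)

/-! ### Band-limited Schwartz functions -/

open LineDeriv in
-- Differentiation is multiplication by a polynomial on the Fourier side, so it does not enlarge the
-- spectrum.
lemma fourier_iteratedLineDeriv_mul_eq {n : ℕ} {χ H : 𝓢(E n, ℂ)}
    (h : ∀ ξ, χ ξ * (𝓕 H : 𝓢(E n, ℂ)) ξ = (𝓕 H : 𝓢(E n, ℂ)) ξ) {l : ℕ} (m : Fin l → E n) (ξ : E n) :
    χ ξ * (𝓕 (∂^{m} H) : 𝓢(E n, ℂ)) ξ = (𝓕 (∂^{m} H) : 𝓢(E n, ℂ)) ξ := by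
  induction l with
  | zero => simpa using h ξ
  | succ l ih =>
    rw [iteratedLineDerivOp_succ_left, SchwartzMap.fourier_lineDerivOp_eq]
    have ht : (fun x : E n => inner ℝ x (m 0)).HasTemperateGrowth := by fun_prop
    rw [smul_apply, SchwartzMap.smulLeftCLM_apply_apply ht, mul_smul_comm, mul_smul_comm,
      ih (Fin.tail m)]

/-- Fourier inversion gives `H 0 = ∫ 𝓕 H = ∫ χ 𝓕 H`, and the multiplication formula moves the
transform onto `χ`. Translations turn this into a convolution identity. -/
lemma apply_zero_eq_integral {n : ℕ} {χ H : 𝓢(E n, ℂ)}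
    (h : ∀ ξ, χ ξ * (𝓕 H : 𝓢(E n, ℂ)) ξ = (𝓕 H : 𝓢(E n, ℂ)) ξ) :
    H 0 = ∫ w, (𝓕 χ : 𝓢(E n, ℂ)) w * H w := by
  rw [SchwartzMap.integral_fourier_mul_eq]
  simp_rw [h]
  have : H 0 = (𝓕⁻ (𝓕 H : 𝓢(E n, ℂ)) : 𝓢(E n, ℂ)) 0 := by
    rw [FourierTransform.fourierInv_fourier_eq]
  rw [this, SchwartzMap.fourierInv_coe, Real.fourierInv_eq]
  simp

lemma iteratedFDeriv_convKernel {n : ℕ} (g : 𝓢(E n, ℂ)) (l : ℕ) (x z a : E n) :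
    iteratedFDeriv ℝ l (convKernel g x) (z + a) = iteratedFDeriv ℝ l (convKernel g (x - a)) z := by
  rw [← iteratedFDeriv_comp_add_right]
  congr 1
  ext w
  rw [convKernel_apply, convKernel_apply]
  congr 1
  abel

lemma iteratedFDeriv_convKernel_eq_integral {n : ℕ} {χ g : 𝓢(E n, ℂ)}
    (h : ∀ ξ, χ ξ * g (-ξ) = g (-ξ)) (l : ℕ) (m : Fin l → E n) (x z : E n) :
    iteratedFDeriv ℝ l (convKernel g x) z m
      = ∫ w, (𝓕 χ : 𝓢(E n, ℂ)) w * iteratedFDeriv ℝ l (convKernel g (x - w)) z m := by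
  have hG : ∀ ξ, χ ξ * (𝓕 (convKernel g (x - z)) : 𝓢(E n, ℂ)) ξ
      = (𝓕 (convKernel g (x - z)) : 𝓢(E n, ℂ)) ξ := by
    intro ξ
    rw [fourier_convKernel, mul_smul_comm, h]
  have key := apply_zero_eq_integral (fourier_iteratedLineDeriv_mul_eq hG m)
  simp only [SchwartzMap.iteratedLineDerivOp_eq_iteratedFDeriv] at key
  rw [← iteratedFDeriv_convKernel, zero_add] at key
  rw [key]
  congr 1
  ext w
  rw [← zero_add w, iteratedFDeriv_convKernel g l (x - z) 0 w, sub_right_comm,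
    ← iteratedFDeriv_convKernel, zero_add, zero_add]

/-- Translating a Schwartz function by `y` costs a factor `(1 + ‖y‖)^k` in its seminorms. This is
the source of the polynomial growth of the blocks. -/
lemma exists_weighted_iteratedFDeriv_bound {n : ℕ} (g : 𝓢(E n, ℂ)) (k l : ℕ) :
    ∃ C : ℝ, 0 ≤ C ∧ ∀ y z : E n,
      ‖z‖ ^ k * ‖iteratedFDeriv ℝ l (convKernel g y) z‖ ≤ C * (1 + ‖y‖) ^ k := by
  refine ⟨2 ^ k * ((Finset.Iic (k, l)).sup fun m => SchwartzMap.seminorm ℝ m.1 m.2)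
    (convKernel g 0), by positivity, fun y z => ?_⟩
  have h := SchwartzMap.one_add_le_sup_seminorm_apply (𝕜 := ℝ) (m := (k, l)) le_rfl le_rfl
    (convKernel g 0) (z - y)
  have e : iteratedFDeriv ℝ l (convKernel g y) z = iteratedFDeriv ℝ l (convKernel g 0) (z - y) := by
    have := iteratedFDeriv_convKernel g l y (z - y) y
    rwa [sub_add_cancel, sub_self] at this
  have hz : ‖z‖ ≤ (1 + ‖z - y‖) * (1 + ‖y‖) := by
    have h1 : ‖z‖ ≤ ‖z - y‖ + ‖y‖ := by simpa using norm_add_le (z - y) y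
    have h2 := norm_nonneg (z - y)
    have h3 := norm_nonneg y
    nlinarith
  calc ‖z‖ ^ k * ‖iteratedFDeriv ℝ l (convKernel g y) z‖
      ≤ ((1 + ‖z - y‖) * (1 + ‖y‖)) ^ k * ‖iteratedFDeriv ℝ l (convKernel g y) z‖ := by gcongr
    _ = (1 + ‖z - y‖) ^ k * ‖iteratedFDeriv ℝ l (convKernel g 0) (z - y)‖ * (1 + ‖y‖) ^ k := by
        rw [e, mul_pow]; ring
    _ ≤ _ := by gcongr

/-! ### Schwartz functions as weighted jets -/

/-- The bounded continuous function `x ↦ ‖x‖^k D^l g(x)` attached to a Schwartz function `g`. -/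
noncomputable def weightedJet {n : ℕ} (k l : ℕ) :
    𝓢(E n, ℂ) →ₗ[ℂ] BoundedContinuousFunction (E n) (E n [×l]→L[ℝ] ℂ) where
  toFun g := BoundedContinuousFunction.ofNormedAddCommGroup
    (fun x => (‖x‖ ^ k : ℝ) • iteratedFDeriv ℝ l g x)
    ((continuous_norm.pow k).smul ((g.smooth l).continuous_iteratedFDeriv le_rfl))
    (SchwartzMap.seminorm ℝ k l g)
    (fun x => by
      rw [norm_smul, Real.norm_of_nonneg (by positivity)]
      exact SchwartzMap.le_seminorm ℝ k l g x)
  map_add' f g := by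
    ext1 x
    simp only [BoundedContinuousFunction.coe_ofNormedAddCommGroup,
      BoundedContinuousFunction.coe_add, Pi.add_apply]
    rw [← smul_add, ← iteratedFDeriv_add_apply (f.smooth _).contDiffAt (g.smooth _).contDiffAt]
    rfl
  map_smul' c g := by
    ext1 x
    simp only [BoundedContinuousFunction.coe_ofNormedAddCommGroup,
      BoundedContinuousFunction.coe_smul, RingHom.id_apply]
    rw [smul_comm, ← iteratedFDeriv_const_smul_apply (g.smooth _).contDiffAt]
    rfl

lemma weightedJet_apply {n : ℕ} (k l : ℕ) (g : 𝓢(E n, ℂ)) (x : E n) :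
    weightedJet k l g x = (‖x‖ ^ k : ℝ) • iteratedFDeriv ℝ l g x := rfl

lemma seminorm_le_norm_weightedJet {n : ℕ} (k l : ℕ) (g : 𝓢(E n, ℂ)) :
    SchwartzMap.seminorm ℂ k l g ≤ ‖weightedJet k l g‖ := by
  refine SchwartzMap.seminorm_le_bound ℂ k l g (by positivity) fun x => ?_
  have := (weightedJet k l g).norm_coe_le_norm x
  rwa [weightedJet_apply, norm_smul, Real.norm_of_nonneg (by positivity)] at this

lemma norm_weightedJet_convKernel_le {n : ℕ} (g : 𝓢(E n, ℂ)) (k l : ℕ) :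
    ∃ C : ℝ, 0 ≤ C ∧ ∀ y : E n, ‖weightedJet k l (convKernel g y)‖ ≤ C * (1 + ‖y‖) ^ k := by
  obtain ⟨C, hC, h⟩ := exists_weighted_iteratedFDeriv_bound g k l
  refine ⟨C, hC, fun y => (BoundedContinuousFunction.norm_le (by positivity)).2 fun z => ?_⟩
  rw [weightedJet_apply, norm_smul, Real.norm_of_nonneg (by positivity)]
  exact h y z

/-- The derivative in `y` is a jet of order `l + 1`, bounded uniformly in `z` for `y` in a unit
ball, so the mean value inequality gives a local Lipschitz bound in sup norm. -/
lemma continuous_weightedJet_convKernel {n : ℕ} (g : 𝓢(E n, ℂ)) (k l : ℕ) :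
    Continuous fun y : E n => weightedJet k l (convKernel g y) := by
  obtain ⟨C, hC, h⟩ := exists_weighted_iteratedFDeriv_bound g k (l + 1)
  have hder : ∀ z y : E n, HasFDerivAt
      (fun y => iteratedFDeriv ℝ l (convKernel g y) z)
      ((fderiv ℝ (iteratedFDeriv ℝ l (convKernel g y)) z).comp (-ContinuousLinearMap.id ℝ (E n)))
      y := by
    intro z y
    have e : ∀ y, iteratedFDeriv ℝ l (convKernel g y) = fun z =>
        iteratedFDeriv ℝ l (convKernel g 0) (z - y) := fun y => by
      ext1 z
      have := iteratedFDeriv_convKernel g l y (z - y) y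
      rwa [sub_add_cancel, sub_self] at this
    have e' : (fun y => iteratedFDeriv ℝ l (convKernel g y) z) = fun y =>
        iteratedFDeriv ℝ l (convKernel g 0) (z - y) := funext fun y => congrFun (e y) z
    have hd : Differentiable ℝ (iteratedFDeriv ℝ l (convKernel g 0)) :=
      ((convKernel g 0).smooth (l + 1 : ℕ)).differentiable_iteratedFDeriv
        (by exact_mod_cast Nat.lt_succ_self l)
    rw [e', e y, fderiv_comp_sub]
    exact (hd (z - y)).hasFDerivAt.comp y ((hasFDerivAt_id y).const_sub z)
  rw [continuous_iff_continuousAt]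
  intro y₀
  have hlip : ∀ y ∈ Metric.ball y₀ 1,
      dist (weightedJet k l (convKernel g y)) (weightedJet k l (convKernel g y₀))
        ≤ C * (2 + ‖y₀‖) ^ k * dist y y₀ := by
    intro y hy
    refine (BoundedContinuousFunction.dist_le (by positivity)).2 fun z => ?_
    rw [dist_eq_norm, dist_eq_norm, weightedJet_apply, weightedJet_apply]
    refine (convex_ball y₀ 1).norm_image_sub_le_of_norm_hasFDerivWithin_le
      (f := fun y => (‖z‖ ^ k : ℝ) • iteratedFDeriv ℝ l (convKernel g y) z)
      (fun y' _ => ((hder z y').const_smul (‖z‖ ^ k : ℝ)).hasFDerivWithinAt)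
      (fun y' hy' => ?_) (Metric.mem_ball_self one_pos) hy
    have hy'' : ‖y'‖ ≤ 1 + ‖y₀‖ := by
      have h1 : ‖y' - y₀‖ < 1 := by simpa [dist_eq_norm] using hy'
      have h2 : ‖y'‖ ≤ ‖y' - y₀‖ + ‖y₀‖ := by simpa using norm_add_le (y' - y₀) y₀
      linarith
    calc _ ≤ ‖z‖ ^ k * ‖iteratedFDeriv ℝ (l + 1) (convKernel g y') z‖ := by
          rw [norm_smul, Real.norm_of_nonneg (by positivity), ← norm_fderiv_iteratedFDeriv]
          gcongr
          refine (ContinuousLinearMap.opNorm_comp_le _ _).trans ?_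
          rw [norm_neg]
          exact mul_le_of_le_one_right (norm_nonneg _) ContinuousLinearMap.norm_id_le
      _ ≤ C * (1 + ‖y'‖) ^ k := h y' z
      _ ≤ _ := mul_le_mul_of_nonneg_left
          (pow_le_pow_left₀ (by positivity) (by linarith) _) hC
  rw [ContinuousAt, tendsto_iff_dist_tendsto_zero]
  have hlim : Filter.Tendsto (fun y => C * (2 + ‖y₀‖) ^ k * dist y y₀) (nhds y₀) (nhds 0) := by
    have : Continuous fun y => C * (2 + ‖y₀‖) ^ k * dist y y₀ := by fun_prop
    simpa using this.tendsto y₀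
  refine squeeze_zero' (Filter.Eventually.of_forall fun _ => dist_nonneg) ?_ hlim
  filter_upwards [Metric.ball_mem_nhds y₀ one_pos] with y hy using hlip y hy

/-- The Banach space of finite families of weighted jets. -/
def JetSpace (n : ℕ) (s : Finset (ℕ × ℕ)) : Type :=
  (i : s) → BoundedContinuousFunction (E n) (E n [×i.1.2]→L[ℝ] ℂ)

noncomputable instance (n : ℕ) (s : Finset (ℕ × ℕ)) : NormedAddCommGroup (JetSpace n s) :=
  inferInstanceAs (NormedAddCommGroup
    ((i : s) → BoundedContinuousFunction (E n) (E n [×i.1.2]→L[ℝ] ℂ)))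

noncomputable instance (n : ℕ) (s : Finset (ℕ × ℕ)) : NormedSpace ℂ (JetSpace n s) :=
  inferInstanceAs (NormedSpace ℂ
    ((i : s) → BoundedContinuousFunction (E n) (E n [×i.1.2]→L[ℝ] ℂ)))

instance (n : ℕ) (s : Finset (ℕ × ℕ)) : CompleteSpace (JetSpace n s) :=
  inferInstanceAs (CompleteSpace
    ((i : s) → BoundedContinuousFunction (E n) (E n [×i.1.2]→L[ℝ] ℂ)))

/-- The family of weighted jets of a Schwartz function. -/
noncomputable def jets {n : ℕ} (s : Finset (ℕ × ℕ)) : 𝓢(E n, ℂ) →ₗ[ℂ] JetSpace n s where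
  toFun g := fun i => weightedJet i.1.1 i.1.2 g
  map_add' f g := funext fun i => map_add (weightedJet i.1.1 i.1.2) f g
  map_smul' c g := funext fun i => map_smul (weightedJet i.1.1 i.1.2) c g

lemma JetSpace.norm_apply_le {n : ℕ} {s : Finset (ℕ × ℕ)} (b : JetSpace n s) (i : s) :
    ‖b i‖ ≤ ‖b‖ :=
  norm_le_pi_norm (f := (b : (i : s) → BoundedContinuousFunction (E n) (E n [×i.1.2]→L[ℝ] ℂ))) i

lemma JetSpace.norm_le {n : ℕ} {s : Finset (ℕ × ℕ)} {b : JetSpace n s} {C : ℝ} (hC : 0 ≤ C)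
    (h : ∀ i, ‖b i‖ ≤ C) : ‖b‖ ≤ C :=
  (pi_norm_le_iff_of_nonneg
    (x := (b : (i : s) → BoundedContinuousFunction (E n) (E n [×i.1.2]→L[ℝ] ℂ))) hC).2 h

/-- Evaluation of a family of jets. -/
noncomputable def JetSpace.evalCLM {n : ℕ} {s : Finset (ℕ × ℕ)} (i : s) (z : E n)
    (m : Fin i.1.2 → E n) : JetSpace n s →L[ℂ] ℂ :=
  LinearMap.mkContinuous
    { toFun := fun b => b i z m
      map_add' := fun _ _ => rfl
      map_smul' := fun _ _ => rfl }
    (∏ k, ‖m k‖) fun b => by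
      calc ‖b i z m‖ ≤ ‖b i z‖ * ∏ k, ‖m k‖ := (b i z).le_opNorm m
        _ ≤ ‖b‖ * ∏ k, ‖m k‖ := by
          gcongr
          exact ((b i).norm_coe_le_norm z).trans (b.norm_apply_le i)
        _ = _ := mul_comm _ _

lemma JetSpace.ext_eval {n : ℕ} {s : Finset (ℕ × ℕ)} {b c : JetSpace n s}
    (h : ∀ i z m, JetSpace.evalCLM i z m b = JetSpace.evalCLM i z m c) : b = c :=
  funext fun i => BoundedContinuousFunction.ext fun z => ContinuousMultilinearMap.ext (h i z)

lemma evalCLM_jets {n : ℕ} {s : Finset (ℕ × ℕ)} (i : s) (z : E n) (m : Fin i.1.2 → E n)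
    (g : 𝓢(E n, ℂ)) :
    JetSpace.evalCLM i z m (jets s g) = (‖z‖ ^ i.1.1 : ℝ) • iteratedFDeriv ℝ i.1.2 g z m := rfl

/-- A linear functional which is bounded by the norm of the image under a linear map factors
through a continuous functional on the target. -/
lemma exists_dual_factor {V B : Type*} [AddCommGroup V] [Module ℂ V] [NormedAddCommGroup B]
    [NormedSpace ℂ B] (J : V →ₗ[ℂ] B) (f : V →ₗ[ℂ] ℂ) (C : ℝ) (h : ∀ v, ‖f v‖ ≤ C * ‖J v‖) :
    ∃ L : B →L[ℂ] ℂ, ∀ v, f v = L (J v) := by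
  -- A linear section of `J` on its range transports `f` there. The bound on `f` forces it to vanish
  -- on the kernel of `J`, so the choice of section is immaterial.
  obtain ⟨σ, hσ⟩ := J.rangeRestrict.exists_rightInverse_of_surjective J.range_rangeRestrict
  have hσ' : ∀ y, J (σ y) = y := fun y => congrArg Subtype.val (LinearMap.congr_fun hσ y)
  let F : LinearMap.range J →L[ℂ] ℂ := (f ∘ₗ σ).mkContinuous C fun y => by
    have := h (σ y)
    rwa [hσ'] at this
  obtain ⟨L, hL, -⟩ := exists_extension_norm_eq (LinearMap.range J) F
  refine ⟨L, fun v => ?_⟩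
  have h1 : L (J v) = f (σ (J.rangeRestrict v)) := hL (J.rangeRestrict v)
  have h2 : ‖f (v - σ (J.rangeRestrict v))‖ ≤ 0 := by
    refine (h _).trans_eq ?_
    rw [map_sub, hσ', show ((J.rangeRestrict v : LinearMap.range J) : B) = J v from rfl, sub_self,
      norm_zero, mul_zero]
  rw [h1, ← sub_eq_zero, ← map_sub]
  exact norm_le_zero_iff.1 h2

/-- A continuous functional is bounded by finitely many Schwartz seminorms, and these are dominated
by sup norms of weighted jets. Hahn–Banach then yields a functional on a Banach space, which
commutes with Bochner integrals. -/
lemma exists_jets_factor {n : ℕ} (f : SchwartzZeroDual n) :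
    ∃ (s : Finset (ℕ × ℕ)) (L : JetSpace n s →L[ℂ] ℂ), ∀ g : schwartzZero n, f g = L (jets s g) := by
  have hw := LinearMap.withSeminorms_induced (schwartz_withSeminorms ℂ (E n) ℂ)
    (schwartzZero n).subtype
  have hcont : Continuous ((normSeminorm ℂ ℂ).comp (f : schwartzZero n →ₗ[ℂ] ℂ)) :=
    continuous_norm.comp f.continuous
  obtain ⟨s, C, -, hs⟩ := Seminorm.bound_of_continuous hw _ hcont
  refine ⟨s, ?_⟩
  refine exists_dual_factor ((jets s).comp (schwartzZero n).subtype) (f : schwartzZero n →ₗ[ℂ] ℂ) C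
    fun g => ?_
  refine (hs g).trans ?_
  rw [smul_apply, NNReal.smul_def, smul_eq_mul]
  gcongr
  refine Seminorm.finset_sup_apply_le (norm_nonneg _) fun i hi => ?_
  exact (seminorm_le_norm_weightedJet i.1 i.2 (g : 𝓢(E n, ℂ))).trans
    ((jets s (g : 𝓢(E n, ℂ))).norm_apply_le ⟨i, hi⟩)

lemma continuous_jets_convKernel {n : ℕ} (s : Finset (ℕ × ℕ)) (g : 𝓢(E n, ℂ)) :
    Continuous fun y : E n => jets s (convKernel g y) :=
  continuous_pi fun i => continuous_weightedJet_convKernel g i.1.1 i.1.2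

lemma exists_norm_jets_convKernel_le {n : ℕ} (s : Finset (ℕ × ℕ)) (g : 𝓢(E n, ℂ)) :
    ∃ (C : ℝ) (N : ℕ), 0 ≤ C ∧ ∀ y : E n, ‖jets s (convKernel g y)‖ ≤ C * (1 + ‖y‖) ^ N := by
  choose C hC h using fun i : ℕ × ℕ => norm_weightedJet_convKernel_le g i.1 i.2
  refine ⟨∑ i ∈ s, C i, s.sup Prod.fst, Finset.sum_nonneg fun i _ => hC i, fun y => ?_⟩
  have hy : 1 ≤ 1 + ‖y‖ := le_add_of_nonneg_right (norm_nonneg y)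
  have hsum : 0 ≤ ∑ i ∈ s, C i := Finset.sum_nonneg fun i _ => hC i
  refine JetSpace.norm_le (by positivity) fun i => (h i.1 y).trans ?_
  gcongr ?_ * ?_
  · exact Finset.single_le_sum (fun i _ => hC i) i.2
  refine pow_le_pow_right₀ hy ?_
  · exact Finset.le_sup (f := Prod.fst) i.2

lemma integrable_norm_mul_one_add_pow {n : ℕ} (K : 𝓢(E n, ℂ)) (N : ℕ) :
    Integrable fun w : E n => ‖K w‖ * (1 + ‖w‖) ^ N := by
  have h0 := (K.integrable_pow_mul volume 0).add (K.integrable_pow_mul volume N)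
  refine (h0.const_mul (2 ^ N)).mono' ?_ (Filter.Eventually.of_forall fun w => ?_)
  · exact (K.continuous.norm.mul ((continuous_const.add continuous_norm).pow N)).aestronglyMeasurable
  · rw [Real.norm_of_nonneg (by positivity)]
    simp only [Pi.add_apply, pow_zero, one_mul]
    have : (1 + ‖w‖) ^ N ≤ 2 ^ N * (1 + ‖w‖ ^ N) := by
      rcases le_total ‖w‖ 1 with hw | hw
      · calc (1 + ‖w‖) ^ N ≤ 2 ^ N := by gcongr; linarith
          _ ≤ _ := le_mul_of_one_le_right (by positivity)
            (le_add_of_nonneg_right (by positivity))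
      · calc (1 + ‖w‖) ^ N ≤ (2 * ‖w‖) ^ N := by gcongr; linarith
          _ = 2 ^ N * ‖w‖ ^ N := mul_pow _ _ _
          _ ≤ _ := by
            gcongr
            linarith
    calc ‖K w‖ * (1 + ‖w‖) ^ N ≤ ‖K w‖ * (2 ^ N * (1 + ‖w‖ ^ N)) := by gcongr
      _ = _ := by ring

/-- Point evaluations of jets are continuous, commute with the integral and separate points, so the
vector-valued identity reduces to the scalar one for derivatives. -/
lemma jets_convKernel_eq_integral {n : ℕ} {χ g : 𝓢(E n, ℂ)} (h : ∀ ξ, χ ξ * g (-ξ) = g (-ξ))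
    (s : Finset (ℕ × ℕ)) (x : E n) :
    Integrable (fun w => (𝓕 χ : 𝓢(E n, ℂ)) w • jets s (convKernel g (x - w))) ∧
    jets s (convKernel g x) = ∫ w, (𝓕 χ : 𝓢(E n, ℂ)) w • jets s (convKernel g (x - w)) := by
  obtain ⟨C, N, hC, hN⟩ := exists_norm_jets_convKernel_le s g
  have hint : Integrable (fun w => (𝓕 χ : 𝓢(E n, ℂ)) w • jets s (convKernel g (x - w))) := by
    refine ((integrable_norm_mul_one_add_pow (𝓕 χ : 𝓢(E n, ℂ)) N).const_mul
      (C * (1 + ‖x‖) ^ N)).mono' ?_ (Filter.Eventually.of_forall fun w => ?_)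
    · exact ((𝓕 χ : 𝓢(E n, ℂ)).continuous.smul ((continuous_jets_convKernel s g).comp
        (continuous_const.sub continuous_id))).aestronglyMeasurable
    · rw [norm_smul]
      have hxw : 1 + ‖x - w‖ ≤ (1 + ‖x‖) * (1 + ‖w‖) := by
        have h1 := norm_sub_le x w
        nlinarith [mul_nonneg (norm_nonneg x) (norm_nonneg w)]
      calc _ ≤ ‖(𝓕 χ : 𝓢(E n, ℂ)) w‖ * (C * ((1 + ‖x‖) * (1 + ‖w‖)) ^ N) := by
            gcongr
            refine (hN _).trans ?_
            gcongr
        _ = _ := by rw [mul_pow]; ring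
  refine ⟨hint, ?_⟩
  refine JetSpace.ext_eval fun i z m => ?_
  rw [← (JetSpace.evalCLM i z m).integral_comp_comm hint, evalCLM_jets,
    iteratedFDeriv_convKernel_eq_integral h, ← integral_smul]
  congr 1
  ext w
  rw [map_smul, evalCLM_jets, smul_comm, smul_eq_mul]

/-- The blocks of a distribution are continuous, of polynomial growth, and reproduced by convolution
with the inverse Fourier transform of a cutoff which equals one on their spectrum. -/
lemma lpBlock_reproducing {n : ℕ} (φ : DyadicPartition n) (j : ℤ) (f : SchwartzZeroDual n)
    {χ : 𝓢(E n, ℂ)} (hχ : ∀ ξ, ‖ξ‖ ≤ (2 : ℝ) ^ (j + 1) → χ ξ = 1) :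
    Continuous (lpBlock φ j f) ∧
    (∃ (B : ℝ) (N : ℕ), 0 ≤ B ∧ ∀ x, ‖lpBlock φ j f x‖ ≤ B * (1 + ‖x‖) ^ N) ∧
    ∀ x, lpBlock φ j f x = ∫ w, (𝓕 χ : 𝓢(E n, ℂ)) w * lpBlock φ j f (x - w) := by
  obtain ⟨s, L, hL⟩ := exists_jets_factor f
  have hu : ∀ x, lpBlock φ j f x = L (jets s (convKernel (φ.toFun j) x)) := fun x => hL _
  -- The transform of `y ↦ φ_j^∨(x - y)` carries the reflected symbol `φ_j(-ξ)`. The support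
  -- condition is radial, so the same cutoff works.
  have h : ∀ ξ, χ ξ * φ.toFun j (-ξ) = φ.toFun j (-ξ) := by
    intro ξ
    by_cases h0 : φ.toFun j (-ξ) = 0
    · rw [h0, mul_zero]
    · have := (φ.support j (subset_tsupport _ h0)).2
      rw [norm_neg] at this
      rw [hχ ξ this, one_mul]
  refine ⟨?_, ?_, fun x => ?_⟩
  · rw [show lpBlock φ j f = fun x => L (jets s (convKernel (φ.toFun j) x)) from funext hu]
    exact L.continuous.comp (continuous_jets_convKernel s _)
  · obtain ⟨C, N, hC, hN⟩ := exists_norm_jets_convKernel_le s (φ.toFun j)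
    refine ⟨‖L‖ * C, N, by positivity, fun x => ?_⟩
    rw [hu, mul_assoc]
    exact (L.le_opNorm _).trans (by gcongr; exact hN x)
  · obtain ⟨hint, heq⟩ := jets_convKernel_eq_integral h s x
    rw [hu, heq, ← L.integral_comp_comm hint]
    simp only [map_smul, smul_eq_mul, hu]

/-- Nikolskii's inequality for the blocks, with a constant independent of the scale. -/
lemma weakNorm_zero_lpBlock_le (n : ℕ) {κ : ℝ} (hκ : 0 ≤ κ) :
    ∃ C : ℝ≥0∞, C ≠ ∞ ∧ ∀ (φ : DyadicPartition n) (j : ℤ) (f : SchwartzZeroDual n),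
      weakNorm 0 (distribFun (lpBlock φ j f))
        ≤ C * ENNReal.ofReal ((2 : ℝ) ^ ((j : ℝ) * (n * κ)))
          * weakNorm κ (distribFun (lpBlock φ j f)) := by
  rcases hκ.eq_or_lt with rfl | hκ
  · exact ⟨1, by simp, fun φ j f => by simp⟩
  obtain ⟨K₁, K₀, hK₁, hK₀, hcut⟩ := exists_dyadic_cutoff n
  refine ⟨ENNReal.ofReal (2 * K₁ * (2 * K₀) ^ κ), ENNReal.ofReal_ne_top, fun φ j f => ?_⟩
  obtain ⟨χ, hχ, hχ1, hχ0⟩ := hcut j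
  obtain ⟨hcont, ⟨B, N, hB, hgrowth⟩, hrep⟩ := lpBlock_reproducing φ j f hχ
  have hK' : ∀ w, ‖(𝓕 χ : 𝓢(E n, ℂ)) w‖ * (1 + ‖w‖) ^ N ≤ 2 ^ N *
      ((Finset.Iic (N, 0)).sup fun m => SchwartzMap.seminorm ℝ m.1 m.2) (𝓕 χ : 𝓢(E n, ℂ)) := by
    intro w
    have := SchwartzMap.one_add_le_sup_seminorm_apply (𝕜 := ℝ) (m := (N, 0)) le_rfl le_rfl
      (𝓕 χ : 𝓢(E n, ℂ)) w
    rwa [norm_iteratedFDeriv_zero, mul_comm] at this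
  refine (weakNorm_zero_le_of_reproducing hcont (𝓕 χ : 𝓢(E n, ℂ)).continuous hB hK₁
    (K₀ := K₀ * (2 : ℝ) ^ ((j : ℝ) * n)) (by positivity) hκ hgrowth hrep hχ1 hχ0 hK').trans_eq ?_
  rw [← ENNReal.ofReal_mul (by positivity)]
  congr 2
  rw [← mul_assoc 2 K₀, Real.mul_rpow (by positivity) (by positivity),
    ← Real.rpow_mul two_pos.le]
  ring_nf

/-! ### Interpolation of Lorentz quasi-norms -/

lemma ofReal_two_rpow (x : ℝ) : ENNReal.ofReal ((2 : ℝ) ^ x) = (2 : ℝ≥0∞) ^ x := by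
  rw [← ENNReal.ofReal_rpow_of_pos two_pos, ENNReal.ofReal_ofNat]

lemma two_rpow_add (x y : ℝ) : (2 : ℝ≥0∞) ^ (x + y) = 2 ^ x * 2 ^ y :=
  ENNReal.rpow_add _ _ two_ne_zero ENNReal.ofNat_ne_top

lemma two_rpow_mul_two_rpow_neg (x : ℝ) : (2 : ℝ≥0∞) ^ (-x) * 2 ^ x = 1 := by
  rw [← two_rpow_add, neg_add_cancel, ENNReal.rpow_zero]

lemma rpow_mul_rpow_ne_top {a b : ℝ≥0∞} {x y : ℝ} (ha : a ≠ ∞) (hb : b ≠ ∞) (hx : 0 ≤ x)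
    (hy : 0 ≤ y) : a ^ x * b ^ y ≠ ∞ :=
  ENNReal.mul_ne_top (ENNReal.rpow_ne_top_of_nonneg hx ha) (ENNReal.rpow_ne_top_of_nonneg hy hb)

lemma recip_pos {p : ℝ≥0∞} (hp : 1 ≤ p) (h : p ≠ ∞) : 0 < recip p := by
  have := toReal_pos_of_one_le hp h
  rw [recip, ENNReal.toReal_inv]
  positivity

lemma eq_of_recip_eq {p p' : ℝ≥0∞} (hp : 1 ≤ p) (hp' : 1 ≤ p') (h : recip p = recip p') : p = p' := by
  have := (ENNReal.toReal_eq_toReal_iff' (inv_ne_top_of_one_le hp) (inv_ne_top_of_one_le hp')).1 h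
  exact inv_injective this

lemma mixNorm_levelFun_eq {n : ℕ} {p q : ℝ≥0∞} (hp : 1 ≤ p) (hpq : p = ∞ → q = ∞) (u : E n → ℂ) :
    mixNorm logMeasure q (levelFun (recip p) (distribFun u))
      = (lorentzConst p q)⁻¹ * lorentzNorm p q u := by
  rw [lorentzNorm_eq hp hpq, ← mul_assoc, ENNReal.inv_mul_cancel (lorentzConst_ne_zero hp hpq)
    (lorentzConst_ne_top hpq), one_mul]

lemma inv_lorentzConst_ne_top {p q : ℝ≥0∞} (hp : 1 ≤ p) (hpq : p = ∞ → q = ∞) :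
    (lorentzConst p q)⁻¹ ≠ ∞ :=
  ENNReal.inv_ne_top.2 (lorentzConst_ne_zero hp hpq)

lemma weakNorm_le_lorentzNorm {p q : ℝ≥0∞} (hp : 1 ≤ p) (hq : 1 ≤ q) (hpq : p = ∞ → q = ∞) :
    ∃ C : ℝ≥0∞, C ≠ ∞ ∧ ∀ {n : ℕ} (u : E n → ℂ),
      weakNorm (recip p) (distribFun u) ≤ C * lorentzNorm p q u := by
  refine ⟨embedConst q * (lorentzConst p q)⁻¹,
    ENNReal.mul_ne_top (embedConst_ne_top q) (inv_lorentzConst_ne_top hp hpq), fun u => ?_⟩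
  rw [mul_assoc, ← mixNorm_levelFun_eq hp hpq]
  exact weakNorm_le_mixNorm (recip_nonneg p) (distribFun_antitone u) hq

lemma lorentzNorm_le_of_le {p q q' : ℝ≥0∞} (hp : 1 ≤ p) (hq : 1 ≤ q) (hqq' : q ≤ q')
    (hpq : p = ∞ → q = ∞) :
    ∃ C : ℝ≥0∞, C ≠ ∞ ∧ ∀ {n : ℕ} (u : E n → ℂ), lorentzNorm p q' u ≤ C * lorentzNorm p q u := by
  have hpq' : p = ∞ → q' = ∞ := fun h => top_le_iff.1 ((hpq h).symm.trans_le hqq')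
  refine ⟨lorentzConst p q' * embedConst q * (lorentzConst p q)⁻¹, ENNReal.mul_ne_top
    (ENNReal.mul_ne_top (lorentzConst_ne_top hpq') (embedConst_ne_top q))
    (inv_lorentzConst_ne_top hp hpq), fun u => ?_⟩
  rw [lorentzNorm_eq hp hpq', mul_assoc, mul_assoc, ← mixNorm_levelFun_eq hp hpq]
  gcongr
  exact mixNorm_levelFun_le (recip_nonneg p) (distribFun_antitone u) hq hqq'

section Interpolation

variable {θ : ℝ} {p p₁ p₂ q q₁ q₂ qStar : ℝ≥0∞}

lemma weakNorm_le_lorentzNorm_mul (hθ0 : 0 < θ) (hθ1 : θ < 1)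
    (hp₁ : 1 ≤ p₁) (hp₂ : 1 ≤ p₂) (hq₁ : 1 ≤ q₁) (hq₂ : 1 ≤ q₂)
    (hpq₁ : p₁ = ∞ → q₁ = ∞) (hpq₂ : p₂ = ∞ → q₂ = ∞) :
    ∃ C : ℝ≥0∞, C ≠ ∞ ∧ ∀ {n : ℕ} (u : E n → ℂ),
      weakNorm (recip p₁) (distribFun u) ^ (1 - θ) * weakNorm (recip p₂) (distribFun u) ^ θ
        ≤ C * (lorentzNorm p₁ q₁ u ^ (1 - θ) * lorentzNorm p₂ q₂ u ^ θ) := by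
  have hθ' : 0 < 1 - θ := by linarith
  obtain ⟨C₁, hC₁, h₁⟩ := weakNorm_le_lorentzNorm hp₁ hq₁ hpq₁
  obtain ⟨C₂, hC₂, h₂⟩ := weakNorm_le_lorentzNorm hp₂ hq₂ hpq₂
  refine ⟨C₁ ^ (1 - θ) * C₂ ^ θ, rpow_mul_rpow_ne_top hC₁ hC₂ hθ'.le hθ0.le, fun u => ?_⟩
  rw [mul_mul_mul_comm, ← ENNReal.mul_rpow_of_nonneg _ _ hθ'.le,
    ← ENNReal.mul_rpow_of_nonneg _ _ hθ0.le]
  gcongr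
  · exact h₁ u
  · exact h₂ u

/-- Hölder on the factorized level function gives second index `q_*`, and the embedding in the
second index raises it to `q`. -/
lemma lorentzNorm_le_of_le_interpolated (hθ0 : 0 < θ) (hθ1 : θ < 1) (hp : 1 ≤ p)
    (hp₁ : 1 ≤ p₁) (hp₂ : 1 ≤ p₂) (hq₁ : 1 ≤ q₁) (hq₂ : 1 ≤ q₂)
    (hpq : p = ∞ → q = ∞) (hpq₁ : p₁ = ∞ → q₁ = ∞) (hpq₂ : p₂ = ∞ → q₂ = ∞)
    (hκ : recip p = (1 - θ) * recip p₁ + θ * recip p₂)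
    (hqStar : qStar⁻¹ = ENNReal.ofReal (1 - θ) * q₁⁻¹ + ENNReal.ofReal θ * q₂⁻¹)
    (hq : qStar ≤ q) :
    ∃ C : ℝ≥0∞, C ≠ ∞ ∧ ∀ {n : ℕ} (u : E n → ℂ),
      lorentzNorm p q u ≤ C * (lorentzNorm p₁ q₁ u ^ (1 - θ) * lorentzNorm p₂ q₂ u ^ θ) := by
  have hθ' : 0 < 1 - θ := by linarith
  set c₁ := (lorentzConst p₁ q₁)⁻¹ with hc₁
  set c₂ := (lorentzConst p₂ q₂)⁻¹ with hc₂
  refine ⟨lorentzConst p q * embedConst qStar * (c₁ ^ (1 - θ) * c₂ ^ θ),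
    ENNReal.mul_ne_top (ENNReal.mul_ne_top (lorentzConst_ne_top hpq) (embedConst_ne_top _))
      (rpow_mul_rpow_ne_top (inv_lorentzConst_ne_top hp₁ hpq₁) (inv_lorentzConst_ne_top hp₂ hpq₂)
        hθ'.le hθ0.le), fun u => ?_⟩
  have hD := distribFun_antitone u
  rw [lorentzNorm_eq hp hpq, mul_assoc, mul_assoc, mul_mul_mul_comm,
    ← ENNReal.mul_rpow_of_nonneg _ _ hθ'.le, ← ENNReal.mul_rpow_of_nonneg _ _ hθ0.le,
    hc₁, hc₂, ← mixNorm_levelFun_eq hp₁ hpq₁, ← mixNorm_levelFun_eq hp₂ hpq₂]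
  gcongr
  refine (mixNorm_levelFun_le (recip_nonneg p) hD
    (one_le_of_inv_eq hθ0 hθ1 hq₁ hq₂ hqStar) hq).trans ?_
  gcongr
  have : levelFun (recip p) (distribFun u) = fun α => levelFun (recip p₁) (distribFun u) α ^ (1 - θ)
      * levelFun (recip p₂) (distribFun u) α ^ θ := by
    rw [hκ]
    exact funext (levelFun_rpow_mul_rpow (recip_nonneg _) (recip_nonneg _) hθ0 hθ1)
  rw [this]
  exact mixNorm_mul_rpow_le hθ0 hθ1 hq₁ hq₂ hqStar (measurable_levelFun hD) (measurable_levelFun hD)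

lemma lorentzNorm_le_weakNorm (hθ0 : 0 < θ) (hθ1 : θ < 1) (hp : 1 ≤ p) (hq : 1 ≤ q)
    (hpq : p = ∞ → q = ∞) {κ₁ κ₂ : ℝ} (hκ₁ : 0 ≤ κ₁) (hκ₂ : 0 ≤ κ₂) (hne : κ₁ ≠ κ₂)
    (hκ : recip p = (1 - θ) * κ₁ + θ * κ₂) :
    ∃ C : ℝ≥0∞, C ≠ ∞ ∧ ∀ {n : ℕ} (u : E n → ℂ),
      lorentzNorm p q u
        ≤ C * (weakNorm κ₁ (distribFun u) ^ (1 - θ) * weakNorm κ₂ (distribFun u) ^ θ) := by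
  obtain ⟨C, hC, h⟩ := mixNorm_levelFun_le_weakNorm hκ₁ hκ₂ hne hθ0 hθ1 hq
  refine ⟨lorentzConst p q * C, ENNReal.mul_ne_top (lorentzConst_ne_top hpq) hC, fun u => ?_⟩
  rw [lorentzNorm_eq hp hpq, hκ, mul_assoc]
  gcongr
  exact h _ (distribFun_antitone u)

/-- Weak-type bounds for the exponents `0` and `κ` control all Lorentz quasi-norms in between,
including the supremum norm. -/
lemma lorentzNorm_le_weakNorm_zero (hp : 1 ≤ p) (hq : 1 ≤ q) (hpq : p = ∞ → q = ∞) {κ : ℝ}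
    (hκ : recip p < κ) :
    ∃ C : ℝ≥0∞, C ≠ ∞ ∧ ∀ {n : ℕ} (u : E n → ℂ),
      lorentzNorm p q u ≤ C * (weakNorm 0 (distribFun u) ^ (1 - recip p / κ)
        * weakNorm κ (distribFun u) ^ (recip p / κ)) := by
  -- Here the interpolation parameter `recip p / κ` is `0`, outside the open range of the
  -- interpolation lemma, and the right side is just the supremum norm.
  by_cases h : p = ∞
  · refine ⟨lorentzConst p q, lorentzConst_ne_top hpq, fun u => ?_⟩
    have h0 : recip p = 0 := by simp [recip, h]
    rw [lorentzNorm_eq hp hpq, h0, hpq h, mixNorm_top]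
    simp [weakNorm]
  · have hpos := recip_pos hp h
    have hκ0 := hpos.trans hκ
    refine lorentzNorm_le_weakNorm (by positivity) ((div_lt_one hκ0).2 hκ) hp hq hpq le_rfl hκ0.le
      hκ0.ne ?_
    rw [mul_zero, zero_add, div_mul_cancel₀ _ hκ0.ne']

end Interpolation

/-! ### Interpolation of Besov-Lorentz quasi-norms -/

lemma mul_lorentzNorm_le_besovNorm {n : ℕ} (φ : DyadicPartition n) (s : ℝ) (p q : ℝ≥0∞) {r : ℝ≥0∞}
    (hr : 1 ≤ r) (f : SchwartzZeroDual n) (j : ℤ) :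
    2 ^ ((j : ℝ) * s) * lorentzNorm p q (lpBlock φ j f) ≤ besovNorm φ s p q r f := by
  rw [← ofReal_two_rpow]
  exact le_seqNorm hr
    (fun j : ℤ => ENNReal.ofReal ((2 : ℝ) ^ ((j : ℝ) * s)) * lorentzNorm p q (lpBlock φ j f)) j

lemma lorentzNorm_le_besovNorm {n : ℕ} (φ : DyadicPartition n) (s : ℝ) (p q : ℝ≥0∞) {r : ℝ≥0∞}
    (hr : 1 ≤ r) (f : SchwartzZeroDual n) (j : ℤ) :
    lorentzNorm p q (lpBlock φ j f) ≤ 2 ^ (-((j : ℝ) * s)) * besovNorm φ s p q r f := by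
  calc _ = 2 ^ (-((j : ℝ) * s)) * (2 ^ ((j : ℝ) * s) * lorentzNorm p q (lpBlock φ j f)) := by
        rw [← mul_assoc, two_rpow_mul_two_rpow_neg, one_mul]
    _ ≤ _ := by
        gcongr
        exact mul_lorentzNorm_le_besovNorm φ s p q hr f j

section Besov

variable {n : ℕ} {φ : DyadicPartition n} {s s₁ s₂ θ : ℝ} {p p₁ p₂ q q₁ q₂ r r₁ r₂ rStar : ℝ≥0∞}

/-- A scale-invariant interpolation inequality for the blocks yields one for the Besov-Lorentz
quasi-norms. -/
lemma besovNorm_le_of_block_le (hθ0 : 0 < θ) (hθ1 : θ < 1) (hr₁ : 1 ≤ r₁) (hr₂ : 1 ≤ r₂)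
    (hrStar : rStar⁻¹ = ENNReal.ofReal (1 - θ) * r₁⁻¹ + ENNReal.ofReal θ * r₂⁻¹) (hr : rStar ≤ r)
    (h : ∃ C : ℝ≥0∞, C ≠ ∞ ∧ ∀ (j : ℤ) (f : SchwartzZeroDual n),
      lorentzNorm p q (lpBlock φ j f) ≤ C * 2 ^ ((j : ℝ) * ((1 - θ) * s₁ + θ * s₂ - s)) *
        (lorentzNorm p₁ q₁ (lpBlock φ j f) ^ (1 - θ) * lorentzNorm p₂ q₂ (lpBlock φ j f) ^ θ)) :
    ∃ C : ℝ≥0∞, C ≠ ∞ ∧ ∀ f : SchwartzZeroDual n, besovNorm φ s p q r f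
      ≤ C * (besovNorm φ s₁ p₁ q₁ r₁ f ^ (1 - θ) * besovNorm φ s₂ p₂ q₂ r₂ f ^ θ) := by
  have hθ' : 0 < 1 - θ := by linarith
  obtain ⟨C, hC, h⟩ := h
  refine ⟨C, hC, fun f => ?_⟩
  have hrs := one_le_of_inv_eq hθ0 hθ1 hr₁ hr₂ hrStar
  have hblock : ∀ j : ℤ,
      ENNReal.ofReal ((2 : ℝ) ^ ((j : ℝ) * s)) * lorentzNorm p q (lpBlock φ j f) ≤
      C * ((ENNReal.ofReal ((2 : ℝ) ^ ((j : ℝ) * s₁)) * lorentzNorm p₁ q₁ (lpBlock φ j f)) ^ (1 - θ)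
        * (ENNReal.ofReal ((2 : ℝ) ^ ((j : ℝ) * s₂)) * lorentzNorm p₂ q₂ (lpBlock φ j f)) ^ θ) := by
    intro j
    simp only [ofReal_two_rpow]
    calc _ ≤ 2 ^ ((j : ℝ) * s) * (C * 2 ^ ((j : ℝ) * ((1 - θ) * s₁ + θ * s₂ - s)) *
          (lorentzNorm p₁ q₁ (lpBlock φ j f) ^ (1 - θ)
            * lorentzNorm p₂ q₂ (lpBlock φ j f) ^ θ)) := by
          gcongr
          exact h j f
      _ = C * ((2 ^ ((j : ℝ) * s) * 2 ^ ((j : ℝ) * ((1 - θ) * s₁ + θ * s₂ - s))) *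
          (lorentzNorm p₁ q₁ (lpBlock φ j f) ^ (1 - θ)
            * lorentzNorm p₂ q₂ (lpBlock φ j f) ^ θ)) := by ring
      _ = _ := by
          rw [← two_rpow_add, ENNReal.mul_rpow_of_nonneg _ _ hθ'.le,
            ENNReal.mul_rpow_of_nonneg _ _ hθ0.le, mul_mul_mul_comm, ← ENNReal.rpow_mul,
            ← ENNReal.rpow_mul, ← two_rpow_add]
          ring_nf
  calc besovNorm φ s p q r f ≤ besovNorm φ s p q rStar f := seqNorm_le_of_le hrs hr _
    _ ≤ _ := seqNorm_mono hblock
    _ = C * _ := seqNorm_const_mul hrs hC _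
    _ ≤ _ := by
        gcongr
        exact seqNorm_mul_rpow_le hθ0 hθ1 hr₁ hr₂ hrStar _ _

/-- Growing and decaying geometric bounds for the weighted block norms yield an interpolation
inequality for the Besov-Lorentz quasi-norms. -/
lemma besovNorm_le_of_two_sided (hθ0 : 0 < θ) (hθ1 : θ < 1) (hr : 1 ≤ r) {d : ℝ} (hd : d ≠ 0) :
    ∃ C : ℝ≥0∞, C ≠ ∞ ∧ ∀ (f : SchwartzZeroDual n) (A₁ A₂ : ℝ≥0∞),
      (∀ j : ℤ, 2 ^ ((j : ℝ) * s) * lorentzNorm p q (lpBlock φ j f)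
        ≤ 2 ^ ((j : ℝ) * (θ * d)) * A₁) →
      (∀ j : ℤ, 2 ^ ((j : ℝ) * s) * lorentzNorm p q (lpBlock φ j f)
        ≤ 2 ^ (-((j : ℝ) * ((1 - θ) * d))) * A₂) →
      besovNorm φ s p q r f ≤ C * (A₁ ^ (1 - θ) * A₂ ^ θ) := by
  obtain ⟨C, hC, h⟩ := tsum_le_of_two_sided hθ0 hθ1 hd
  refine ⟨C, hC, fun f A₁ A₂ h₁ h₂ => ?_⟩
  -- The `l¹` norm dominates every `l^r` norm, so it suffices to sum.
  refine (seqNorm_le_of_le le_rfl hr _).trans ?_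
  rw [seqNorm_one]
  refine h _ A₁ A₂ (fun j => ?_) fun j => ?_
  · simp only [ofReal_two_rpow]
    exact h₁ j
  · simp only [ofReal_two_rpow]
    exact h₂ j

/-- Blockwise interpolation with a gain of integrability. -/
lemma lorentzNorm_lpBlock_le (hθ0 : 0 < θ) (hθ1 : θ < 1) (hp : 1 ≤ p) (hq : 1 ≤ q)
    (hpq : p = ∞ → q = ∞) (hp₁ : 1 ≤ p₁) (hp₂ : 1 ≤ p₂) (hq₁ : 1 ≤ q₁) (hq₂ : 1 ≤ q₂)
    (hpq₁ : p₁ = ∞ → q₁ = ∞) (hpq₂ : p₂ = ∞ → q₂ = ∞) {κ : ℝ} (hκ : recip p < κ)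
    (hκ' : κ = (1 - θ) * recip p₁ + θ * recip p₂) :
    ∃ C : ℝ≥0∞, C ≠ ∞ ∧ ∀ (j : ℤ) (f : SchwartzZeroDual n),
      lorentzNorm p q (lpBlock φ j f) ≤ C * 2 ^ ((j : ℝ) * (n * κ - n * recip p)) *
        (lorentzNorm p₁ q₁ (lpBlock φ j f) ^ (1 - θ) * lorentzNorm p₂ q₂ (lpBlock φ j f) ^ θ) := by
  have hκ0 : 0 < κ := (recip_nonneg p).trans_lt hκ
  set t := recip p / κ with ht
  have ht0 : 0 ≤ t := div_nonneg (recip_nonneg p) hκ0.le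
  have ht1 : 0 < 1 - t := by
    rw [sub_pos, ht, div_lt_one hκ0]
    exact hκ
  obtain ⟨C₁, hC₁, h₁⟩ := lorentzNorm_le_weakNorm_zero hp hq hpq hκ
  obtain ⟨C₂, hC₂, h₂⟩ := weakNorm_zero_lpBlock_le n hκ0.le
  obtain ⟨C₃, hC₃, h₃⟩ := weakNorm_le_lorentzNorm_mul hθ0 hθ1 hp₁ hp₂ hq₁ hq₂ hpq₁ hpq₂
  refine ⟨C₁ * C₂ ^ (1 - t) * C₃, ENNReal.mul_ne_top (ENNReal.mul_ne_top hC₁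
    (ENNReal.rpow_ne_top_of_nonneg ht1.le hC₂)) hC₃, fun j f => ?_⟩
  have hw : weakNorm κ (distribFun (lpBlock φ j f)) ≤ C₃ *
      (lorentzNorm p₁ q₁ (lpBlock φ j f) ^ (1 - θ) * lorentzNorm p₂ q₂ (lpBlock φ j f) ^ θ) := by
    refine le_trans ?_ (h₃ _)
    rw [hκ']
    exact weakNorm_le_rpow_mul_rpow (recip_nonneg _) (recip_nonneg _) hθ0 hθ1
  set W := weakNorm κ (distribFun (lpBlock φ j f)) with hW
  calc _ ≤ C₁ * (weakNorm 0 (distribFun (lpBlock φ j f)) ^ (1 - t) * W ^ t) := h₁ _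
    _ ≤ C₁ * ((C₂ * 2 ^ ((j : ℝ) * (n * κ)) * W) ^ (1 - t) * W ^ t) := by
        gcongr
        rw [← ofReal_two_rpow]
        exact h₂ φ j f
    _ = C₁ * C₂ ^ (1 - t) * 2 ^ ((j : ℝ) * (n * κ - n * recip p)) * (W ^ (1 - t) * W ^ t) := by
        rw [ENNReal.mul_rpow_of_nonneg _ _ ht1.le, ENNReal.mul_rpow_of_nonneg _ _ ht1.le,
          ← ENNReal.rpow_mul]
        -- Only the fraction `1 - t` of the Nikolskii factor is spent, which leaves exactly the gain
        -- from `1/p` to `κ`.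
        have : (j : ℝ) * (n * κ) * (1 - t) = j * (n * κ - n * recip p) := by
          rw [ht]
          field_simp
        rw [this]
        ring
    _ = C₁ * C₂ ^ (1 - t) * 2 ^ ((j : ℝ) * (n * κ - n * recip p)) * W := by
        rw [← ENNReal.rpow_add_of_nonneg _ _ ht1.le ht0, sub_add_cancel, ENNReal.rpow_one]
    _ ≤ C₁ * C₂ ^ (1 - t) * 2 ^ ((j : ℝ) * (n * κ - n * recip p)) * (C₃ *
      (lorentzNorm p₁ q₁ (lpBlock φ j f) ^ (1 - θ) * lorentzNorm p₂ q₂ (lpBlock φ j f) ^ θ)) := by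
        gcongr
    _ = _ := by ring

/-- Interpolation between different smoothness indices at a fixed integrability index. -/
lemma besovNorm_le_of_smoothness_ne (hθ0 : 0 < θ) (hθ1 : θ < 1) (hp : 1 ≤ p) (hq₁ : 1 ≤ q₁)
    (hq₂ : 1 ≤ q₂) (hpq₁ : p = ∞ → q₁ = ∞) (hpq₂ : p = ∞ → q₂ = ∞)
    (hr : 1 ≤ r) (hr₁ : 1 ≤ r₁) (hr₂ : 1 ≤ r₂) (hs : s = (1 - θ) * s₁ + θ * s₂) (hne : s₁ ≠ s₂)
    (hq : max q₁ q₂ ≤ q) :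
    ∃ C : ℝ≥0∞, C ≠ ∞ ∧ ∀ f : SchwartzZeroDual n, besovNorm φ s p q r f
      ≤ C * (besovNorm φ s₁ p q₁ r₁ f ^ (1 - θ) * besovNorm φ s₂ p q₂ r₂ f ^ θ) := by
  have hθ' : 0 < 1 - θ := by linarith
  obtain ⟨C₁, hC₁, h₁⟩ := lorentzNorm_le_of_le hp hq₁ ((le_max_left _ _).trans hq) hpq₁
  obtain ⟨C₂, hC₂, h₂⟩ := lorentzNorm_le_of_le hp hq₂ ((le_max_right _ _).trans hq) hpq₂
  -- With `d = s₂ - s₁` one has `s - s₁ = θ d` and `s - s₂ = -(1-θ) d`, so the two endpoint bounds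
  -- are the required geometric ones.
  obtain ⟨C, hC, h⟩ := besovNorm_le_of_two_sided (φ := φ) (s := s) (p := p) (q := q) hθ0 hθ1 hr
    (sub_ne_zero.2 hne.symm)
  refine ⟨C * (C₁ ^ (1 - θ) * C₂ ^ θ),
    ENNReal.mul_ne_top hC (rpow_mul_rpow_ne_top hC₁ hC₂ hθ'.le hθ0.le), fun f => ?_⟩
  rw [mul_assoc, mul_mul_mul_comm, ← ENNReal.mul_rpow_of_nonneg _ _ hθ'.le,
    ← ENNReal.mul_rpow_of_nonneg _ _ hθ0.le]
  refine h f _ _ (fun j => ?_) fun j => ?_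
  · calc _ ≤ 2 ^ ((j : ℝ) * s) * (C₁ * (2 ^ (-((j : ℝ) * s₁)) * besovNorm φ s₁ p q₁ r₁ f)) := by
          gcongr
          refine (h₁ _).trans ?_
          gcongr
          exact lorentzNorm_le_besovNorm φ s₁ p q₁ hr₁ f j
      _ = (2 ^ ((j : ℝ) * s) * 2 ^ (-((j : ℝ) * s₁))) * (C₁ * besovNorm φ s₁ p q₁ r₁ f) := by ring
      _ = _ := by
          rw [← two_rpow_add, hs]
          ring_nf
  · calc _ ≤ 2 ^ ((j : ℝ) * s) * (C₂ * (2 ^ (-((j : ℝ) * s₂)) * besovNorm φ s₂ p q₂ r₂ f)) := by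
          gcongr
          refine (h₂ _).trans ?_
          gcongr
          exact lorentzNorm_le_besovNorm φ s₂ p q₂ hr₂ f j
      _ = (2 ^ ((j : ℝ) * s) * 2 ^ (-((j : ℝ) * s₂))) * (C₂ * besovNorm φ s₂ p q₂ r₂ f) := by ring
      _ = _ := by
          rw [← two_rpow_add, hs]
          ring_nf

/-- Interpolation with a gain of integrability between spaces of different differential
dimension. -/
lemma besovNorm_le_of_dimension_ne (hθ0 : 0 < θ) (hθ1 : θ < 1) (hp : 1 ≤ p) (hq : 1 ≤ q)
    (hpq : p = ∞ → q = ∞) (hp₁ : 1 ≤ p₁) (hp₂ : 1 ≤ p₂) (hq₁ : 1 ≤ q₁) (hq₂ : 1 ≤ q₂)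
    (hpq₁ : p₁ = ∞ → q₁ = ∞) (hpq₂ : p₂ = ∞ → q₂ = ∞)
    (hr : 1 ≤ r) (hr₁ : 1 ≤ r₁) (hr₂ : 1 ≤ r₂) {κ : ℝ} (hκ : recip p < κ)
    (hκ' : κ = (1 - θ) * recip p₁ + θ * recip p₂)
    (hs : (1 - θ) * s₁ + θ * s₂ - s = n * κ - n * recip p)
    (hne : s₂ - s₁ ≠ n * recip p₂ - n * recip p₁) :
    ∃ C : ℝ≥0∞, C ≠ ∞ ∧ ∀ f : SchwartzZeroDual n, besovNorm φ s p q r f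
      ≤ C * (besovNorm φ s₁ p₁ q₁ r₁ f ^ (1 - θ) * besovNorm φ s₂ p₂ q₂ r₂ f ^ θ) := by
  have hθ' : 0 < 1 - θ := by linarith
  have hκ0 : 0 < κ := (recip_nonneg p).trans_lt hκ
  set t := recip p / κ with ht
  have ht0 : 0 ≤ t := div_nonneg (recip_nonneg p) hκ0.le
  have ht1 : 0 < 1 - t := by
    rw [sub_pos, ht, div_lt_one hκ0]
    exact hκ
  have htκ : t * κ = recip p := div_mul_cancel₀ _ hκ0.ne'
  -- The difference of the differential dimensions, scaled by the exponent `1 - t` with which the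
  -- supremum norm enters.
  set d := (1 - t) * ((s₂ - n * recip p₂) - (s₁ - n * recip p₁)) with hd
  have hd0 : d ≠ 0 := mul_ne_zero ht1.ne' fun h => hne (by linarith)
  obtain ⟨C₁, hC₁, h₁⟩ := lorentzNorm_le_weakNorm_zero hp hq hpq hκ
  obtain ⟨C₂, hC₂, h₂⟩ := weakNorm_zero_lpBlock_le n (recip_nonneg p₁)
  obtain ⟨C₃, hC₃, h₃⟩ := weakNorm_zero_lpBlock_le n (recip_nonneg p₂)
  obtain ⟨C₄, hC₄, h₄⟩ := weakNorm_le_lorentzNorm_mul hθ0 hθ1 hp₁ hp₂ hq₁ hq₂ hpq₁ hpq₂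
  obtain ⟨C₅, hC₅, h₅⟩ := weakNorm_le_lorentzNorm hp₁ hq₁ hpq₁
  obtain ⟨C₆, hC₆, h₆⟩ := weakNorm_le_lorentzNorm hp₂ hq₂ hpq₂
  obtain ⟨C, hC, h⟩ := besovNorm_le_of_two_sided (φ := φ) (s := s) (p := p) (q := q) hθ0 hθ1 hr hd0
  set M₁ := C₁ * C₄ ^ t * (C₂ * C₅) ^ (1 - t) with hM₁
  set M₂ := C₁ * C₄ ^ t * (C₃ * C₆) ^ (1 - t) with hM₂
  have hM₁t : M₁ ≠ ∞ := ENNReal.mul_ne_top (ENNReal.mul_ne_top hC₁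
    (ENNReal.rpow_ne_top_of_nonneg ht0 hC₄))
    (ENNReal.rpow_ne_top_of_nonneg ht1.le (ENNReal.mul_ne_top hC₂ hC₅))
  have hM₂t : M₂ ≠ ∞ := ENNReal.mul_ne_top (ENNReal.mul_ne_top hC₁
    (ENNReal.rpow_ne_top_of_nonneg ht0 hC₄))
    (ENNReal.rpow_ne_top_of_nonneg ht1.le (ENNReal.mul_ne_top hC₃ hC₆))
  refine ⟨C * (M₁ ^ (1 - θ) * M₂ ^ θ),
    ENNReal.mul_ne_top hC (rpow_mul_rpow_ne_top hM₁t hM₂t hθ'.le hθ0.le), fun f => ?_⟩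
  set X₁ := besovNorm φ s₁ p₁ q₁ r₁ f with hX₁
  set X₂ := besovNorm φ s₂ p₂ q₂ r₂ f with hX₂
  set P := X₁ ^ (1 - θ) * X₂ ^ θ with hP
  have hweak : ∀ j : ℤ, weakNorm κ (distribFun (lpBlock φ j f))
      ≤ C₄ * (2 ^ (-((j : ℝ) * ((1 - θ) * s₁ + θ * s₂))) * P) := by
    intro j
    calc _ ≤ weakNorm (recip p₁) (distribFun (lpBlock φ j f)) ^ (1 - θ)
          * weakNorm (recip p₂) (distribFun (lpBlock φ j f)) ^ θ := by
          rw [hκ']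
          exact weakNorm_le_rpow_mul_rpow (recip_nonneg _) (recip_nonneg _) hθ0 hθ1
      _ ≤ _ := h₄ _
      _ ≤ C₄ * ((2 ^ (-((j : ℝ) * s₁)) * X₁) ^ (1 - θ) * (2 ^ (-((j : ℝ) * s₂)) * X₂) ^ θ) := by
          gcongr
          · exact lorentzNorm_le_besovNorm φ s₁ p₁ q₁ hr₁ f j
          · exact lorentzNorm_le_besovNorm φ s₂ p₂ q₂ hr₂ f j
      _ = _ := by
          rw [ENNReal.mul_rpow_of_nonneg _ _ hθ'.le, ENNReal.mul_rpow_of_nonneg _ _ hθ0.le,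
            mul_mul_mul_comm, ← ENNReal.rpow_mul, ← ENNReal.rpow_mul, ← two_rpow_add, ← hP]
          ring_nf
  -- The weak norm at `κ` is always bounded by the mean `P` of both data, while the supremum is
  -- bounded by a single datum `X`. Using `X₁` or `X₂` here produces the growing and the decaying
  -- bound.
  have side : ∀ (j : ℤ) (s' κ' e : ℝ) (C' X : ℝ≥0∞),
      weakNorm 0 (distribFun (lpBlock φ j f)) ≤ C' * (2 ^ ((j : ℝ) * (n * κ' - s')) * X) →
      e = (1 - t) * ((1 - θ) * (s₁ - n * recip p₁) + θ * (s₂ - n * recip p₂) - (s' - n * κ')) →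
      2 ^ ((j : ℝ) * s) * lorentzNorm p q (lpBlock φ j f)
        ≤ 2 ^ ((j : ℝ) * e) * (C₁ * C₄ ^ t * C' ^ (1 - t) * (P ^ t * X ^ (1 - t))) := by
    intro j s' κ' e C' X hX he
    calc _ ≤ 2 ^ ((j : ℝ) * s) * (C₁ * ((C' * (2 ^ ((j : ℝ) * (n * κ' - s')) * X)) ^ (1 - t)
          * (C₄ * (2 ^ (-((j : ℝ) * ((1 - θ) * s₁ + θ * s₂))) * P)) ^ t)) := by
          gcongr
          refine (h₁ _).trans ?_
          gcongr
          exact hweak j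
      _ = (2 ^ ((j : ℝ) * s) * 2 ^ ((j : ℝ) * (n * κ' - s') * (1 - t))
            * 2 ^ (-((j : ℝ) * ((1 - θ) * s₁ + θ * s₂)) * t))
          * (C₁ * C₄ ^ t * C' ^ (1 - t) * (P ^ t * X ^ (1 - t))) := by
          simp only [ENNReal.mul_rpow_of_nonneg _ _ ht1.le, ENNReal.mul_rpow_of_nonneg _ _ ht0,
            ENNReal.rpow_mul]
          ring
      _ = _ := by
          rw [← two_rpow_add, ← two_rpow_add]
          congr 2
          have e1 : s = (1 - θ) * s₁ + θ * s₂ - n * κ + n * (t * κ) := by rw [htκ]; linarith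
          rw [he, e1, hκ']
          ring
  have h₁' : ∀ j : ℤ, weakNorm 0 (distribFun (lpBlock φ j f))
      ≤ C₂ * C₅ * (2 ^ ((j : ℝ) * (n * recip p₁ - s₁)) * X₁) := by
    intro j
    calc _ ≤ C₂ * 2 ^ ((j : ℝ) * (n * recip p₁)) * (C₅ * (2 ^ (-((j : ℝ) * s₁)) * X₁)) := by
          refine (h₂ φ j f).trans ?_
          rw [ofReal_two_rpow]
          gcongr
          refine (h₅ _).trans ?_
          gcongr
          exact lorentzNorm_le_besovNorm φ s₁ p₁ q₁ hr₁ f j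
      _ = C₂ * C₅ * ((2 ^ ((j : ℝ) * (n * recip p₁)) * 2 ^ (-((j : ℝ) * s₁))) * X₁) := by ring
      _ = _ := by
          rw [← two_rpow_add]
          ring_nf
  have h₂' : ∀ j : ℤ, weakNorm 0 (distribFun (lpBlock φ j f))
      ≤ C₃ * C₆ * (2 ^ ((j : ℝ) * (n * recip p₂ - s₂)) * X₂) := by
    intro j
    calc _ ≤ C₃ * 2 ^ ((j : ℝ) * (n * recip p₂)) * (C₆ * (2 ^ (-((j : ℝ) * s₂)) * X₂)) := by
          refine (h₃ φ j f).trans ?_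
          rw [ofReal_two_rpow]
          gcongr
          refine (h₆ _).trans ?_
          gcongr
          exact lorentzNorm_le_besovNorm φ s₂ p₂ q₂ hr₂ f j
      _ = C₃ * C₆ * ((2 ^ ((j : ℝ) * (n * recip p₂)) * 2 ^ (-((j : ℝ) * s₂))) * X₂) := by ring
      _ = _ := by
          rw [← two_rpow_add]
          ring_nf
  have hfin := h f (M₁ * (P ^ t * X₁ ^ (1 - t))) (M₂ * (P ^ t * X₂ ^ (1 - t)))
    (fun j => side j s₁ (recip p₁) (θ * d) _ X₁ (h₁' j) (by rw [hd]; ring))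
    (fun j => by
      rw [← mul_neg]
      exact side j s₂ (recip p₂) (-((1 - θ) * d)) _ X₂ (h₂' j) (by rw [hd]; ring))
  refine hfin.trans_eq ?_
  -- The geometric mean of `X₁` and `X₂` is `P` again, so the powers `P^t` and `P^(1-t)` recombine.
  have hPP : (P ^ t * X₁ ^ (1 - t)) ^ (1 - θ) * (P ^ t * X₂ ^ (1 - t)) ^ θ = P := by
    rw [ENNReal.mul_rpow_of_nonneg _ _ hθ'.le, ENNReal.mul_rpow_of_nonneg _ _ hθ0.le,
      mul_mul_mul_comm, ← ENNReal.rpow_add_of_nonneg _ _ hθ'.le hθ0.le, sub_add_cancel,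
      ENNReal.rpow_one, ← ENNReal.rpow_mul, ← ENNReal.rpow_mul, mul_comm (1 - t) (1 - θ),
      mul_comm (1 - t) θ, ENNReal.rpow_mul, ENNReal.rpow_mul,
      ← ENNReal.mul_rpow_of_nonneg _ _ ht1.le, ← hP,
      ← ENNReal.rpow_add_of_nonneg _ _ ht0 ht1.le, add_sub_cancel, ENNReal.rpow_one]
  rw [ENNReal.mul_rpow_of_nonneg M₁ _ hθ'.le, ENNReal.mul_rpow_of_nonneg M₂ _ hθ0.le,
    mul_mul_mul_comm, hPP]
  ring

end Besov

/-- The interpolation inequality for Besov-Lorentz quasi-norms with values in `[0, ∞]`. -/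
theorem exists_besovNorm_interpolation (n : ℕ) (hn : 1 ≤ n) (φ : DyadicPartition n)
    (s s₁ s₂ sStar θ : ℝ) (p p₁ p₂ pStar q q₁ q₂ qStar r r₁ r₂ rStar : ℝ≥0∞)
    (hθ0 : 0 < θ) (hθ1 : θ < 1)
    (hp : 1 ≤ p) (hp₁ : 1 ≤ p₁) (hp₂ : 1 ≤ p₂)
    (hq : 1 ≤ q) (hq₁ : 1 ≤ q₁) (hq₂ : 1 ≤ q₂)
    (hr : 1 ≤ r) (hr₁ : 1 ≤ r₁) (hr₂ : 1 ≤ r₂)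
    (hpq : p = ∞ → q = ∞) (hpq₁ : p₁ = ∞ → q₁ = ∞) (hpq₂ : p₂ = ∞ → q₂ = ∞)
    (hsStar : sStar = (1 - θ) * s₁ + θ * s₂)
    (hpStar : pStar⁻¹ = ENNReal.ofReal (1 - θ) * p₁⁻¹ + ENNReal.ofReal θ * p₂⁻¹)
    (hqStar : qStar⁻¹ = ENNReal.ofReal (1 - θ) * q₁⁻¹ + ENNReal.ofReal θ * q₂⁻¹)
    (hrStar : rStar⁻¹ = ENNReal.ofReal (1 - θ) * r₁⁻¹ + ENNReal.ofReal θ * r₂⁻¹)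
    (hscale : sStar - s = n * recip pStar - n * recip p)
    (hnonneg : 0 ≤ n * recip pStar - n * recip p)
    (hcond :
      (qStar ≤ q ∧ rStar ≤ r) ∨
      (sStar = s ∧ p₁ ≠ p₂ ∧ rStar ≤ r) ∨
      (s < sStar ∧ rStar ≤ r) ∨
      (sStar = s ∧ s₁ ≠ s₂ ∧ p₁ = p₂ ∧ max q₁ q₂ ≤ q) ∨
      (s < sStar ∧
        s₂ - s₁ ≠ n * recip p₂ - n * recip p₁)) :
    ∃ C : ℝ≥0∞, C ≠ ∞ ∧ ∀ f : SchwartzZeroDual n, besovNorm φ s p q r f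
      ≤ C * (besovNorm φ s₁ p₁ q₁ r₁ f ^ (1 - θ) * besovNorm φ s₂ p₂ q₂ r₂ f ^ θ) := by

  have hnpos : (0 : ℝ) < n := by exact_mod_cast hn
  have hκ' := recip_eq_of_inv_eq hθ0 hθ1 hp₁ hp₂ hpStar
  -- The scaling relation with `n ≥ 1` converts a strict loss of smoothness into a strict gain of
  -- integrability.
  have hgain : s < sStar → recip p < recip pStar := fun hlt => by
    refine lt_of_mul_lt_mul_left ?_ hnpos.le
    linarith
  have heq : sStar = s → recip p = recip pStar := fun h => by
    refine mul_left_cancel₀ hnpos.ne' ?_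
    linarith
  have improving : s < sStar → rStar ≤ r → ∃ C : ℝ≥0∞, C ≠ ∞ ∧ ∀ f : SchwartzZeroDual n,
      besovNorm φ s p q r f
        ≤ C * (besovNorm φ s₁ p₁ q₁ r₁ f ^ (1 - θ) * besovNorm φ s₂ p₂ q₂ r₂ f ^ θ) := by
    intro hlt hrr
    refine besovNorm_le_of_block_le hθ0 hθ1 hr₁ hr₂ hrStar hrr ?_
    rw [← hsStar, hscale]
    exact lorentzNorm_lpBlock_le hθ0 hθ1 hp hq hpq hp₁ hp₂ hq₁ hq₂ hpq₁ hpq₂ (hgain hlt) hκ'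
  have stationary : sStar = s → rStar ≤ r → (∃ C : ℝ≥0∞, C ≠ ∞ ∧ ∀ {n : ℕ} (u : E n → ℂ),
      lorentzNorm p q u ≤ C * (lorentzNorm p₁ q₁ u ^ (1 - θ) * lorentzNorm p₂ q₂ u ^ θ)) →
      ∃ C : ℝ≥0∞, C ≠ ∞ ∧ ∀ f : SchwartzZeroDual n, besovNorm φ s p q r f
        ≤ C * (besovNorm φ s₁ p₁ q₁ r₁ f ^ (1 - θ) * besovNorm φ s₂ p₂ q₂ r₂ f ^ θ) := by
    rintro hs hrr ⟨C, hC, h⟩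
    refine besovNorm_le_of_block_le hθ0 hθ1 hr₁ hr₂ hrStar hrr ⟨C, hC, fun j f => ?_⟩
    rw [← hsStar, hs, sub_self, mul_zero, ENNReal.rpow_zero, mul_one]
    exact h _
  rcases hcond with ⟨hqq, hrr⟩ | ⟨hs, hpne, hrr⟩ | ⟨hlt, hrr⟩ | ⟨hs, hsne, hpp, hqq⟩ | ⟨hlt, hne⟩
  · rcases (show s ≤ sStar by linarith).eq_or_lt with hs | hlt
    · exact stationary hs.symm hrr (lorentzNorm_le_of_le_interpolated hθ0 hθ1 hp hp₁ hp₂ hq₁ hq₂ hpq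
        hpq₁ hpq₂ ((heq hs.symm).trans hκ') hqStar hqq)
    · exact improving hlt hrr
  · refine stationary hs hrr ?_
    obtain ⟨C₁, hC₁, h₁⟩ := lorentzNorm_le_weakNorm hθ0 hθ1 hp hq hpq (recip_nonneg p₁)
      (recip_nonneg p₂) (fun h => hpne (eq_of_recip_eq hp₁ hp₂ h)) ((heq hs).trans hκ')
    obtain ⟨C₂, hC₂, h₂⟩ := weakNorm_le_lorentzNorm_mul hθ0 hθ1 hp₁ hp₂ hq₁ hq₂ hpq₁ hpq₂
    refine ⟨C₁ * C₂, ENNReal.mul_ne_top hC₁ hC₂, fun u => (h₁ u).trans ?_⟩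
    rw [mul_assoc]
    exact mul_le_mul' le_rfl (h₂ u)
  · exact improving hlt hrr
  · have hpp₁ : p = p₁ := by
      refine eq_of_recip_eq hp hp₁ ?_
      rw [heq hs, hκ', ← hpp]
      ring
    rw [← hpp, ← hpp₁]
    rw [← hpp₁] at hpq₁
    rw [← hpp, ← hpp₁] at hpq₂
    exact besovNorm_le_of_smoothness_ne hθ0 hθ1 hp hq₁ hq₂ hpq₁ hpq₂ hr hr₁ hr₂
      (hs.symm.trans hsStar) hsne hqq
  · exact besovNorm_le_of_dimension_ne hθ0 hθ1 hp hq hpq hp₁ hp₂ hq₁ hq₂ hpq₁ hpq₂ hr hr₁ hr₂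
      (hgain hlt) hκ' (by rw [← hsStar]; exact hscale) hne

end BesovLorentz

theorem theorem4p2 (n : ℕ) (hn : 1 ≤ n) (φ : BesovLorentz.DyadicPartition n)
    (s s₁ s₂ sStar θ : ℝ) (p p₁ p₂ pStar q q₁ q₂ qStar r r₁ r₂ rStar : ℝ≥0∞)
    (hθ0 : 0 < θ) (hθ1 : θ < 1)
    (hp : 1 ≤ p) (hp₁ : 1 ≤ p₁) (hp₂ : 1 ≤ p₂)
    (hq : 1 ≤ q) (hq₁ : 1 ≤ q₁) (hq₂ : 1 ≤ q₂)
    (hr : 1 ≤ r) (hr₁ : 1 ≤ r₁) (hr₂ : 1 ≤ r₂)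
    (hpq : p = ∞ → q = ∞) (hpq₁ : p₁ = ∞ → q₁ = ∞) (hpq₂ : p₂ = ∞ → q₂ = ∞)
    (hsStar : sStar = (1 - θ) * s₁ + θ * s₂)
    (hpStar : pStar⁻¹ = ENNReal.ofReal (1 - θ) * p₁⁻¹ + ENNReal.ofReal θ * p₂⁻¹)
    (hqStar : qStar⁻¹ = ENNReal.ofReal (1 - θ) * q₁⁻¹ + ENNReal.ofReal θ * q₂⁻¹)
    (hrStar : rStar⁻¹ = ENNReal.ofReal (1 - θ) * r₁⁻¹ + ENNReal.ofReal θ * r₂⁻¹)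
    (hscale : sStar - s = n * BesovLorentz.recip pStar - n * BesovLorentz.recip p)
    (hnonneg : 0 ≤ n * BesovLorentz.recip pStar - n * BesovLorentz.recip p)
    (hcond :
      (qStar ≤ q ∧ rStar ≤ r) ∨
      (sStar = s ∧ p₁ ≠ p₂ ∧ rStar ≤ r) ∨
      (s < sStar ∧ rStar ≤ r) ∨
      (sStar = s ∧ s₁ ≠ s₂ ∧ p₁ = p₂ ∧ max q₁ q₂ ≤ q) ∨
      (s < sStar ∧
        s₂ - s₁ ≠ n * BesovLorentz.recip p₂ - n * BesovLorentz.recip p₁)) :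
    ∃ C : ℝ≥0, ∀ f ∈ BesovLorentz.besovSpace φ s₁ p₁ q₁ r₁ ∩ BesovLorentz.besovSpace φ s₂ p₂ q₂ r₂,
      BesovLorentz.besovNorm φ s p q r f ≤
        C * BesovLorentz.besovNorm φ s₁ p₁ q₁ r₁ f ^ (1 - θ)
          * BesovLorentz.besovNorm φ s₂ p₂ q₂ r₂ f ^ θ := by
  obtain ⟨C, hC, h⟩ := BesovLorentz.exists_besovNorm_interpolation n hn φ s s₁ s₂ sStar θ
    p p₁ p₂ pStar q q₁ q₂ qStar r r₁ r₂ rStar hθ0 hθ1 hp hp₁ hp₂ hq hq₁ hq₂ hr hr₁ hr₂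
    hpq hpq₁ hpq₂ hsStar hpStar hqStar hrStar hscale hnonneg hcond
  refine ⟨C.toNNReal, fun f _ => ?_⟩
  rw [ENNReal.coe_toNNReal hC, mul_assoc]
  exact h f
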